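/- Let $\Sigma$ be a compact Riemann surface, $A\subset\Sigma$ a finite subset, $\mathcal K$ the canonical line bundle and $L$ a theta characteristic, i.e. a holomorphic line bundle with $L^{\otimes 2}=\mathcal K$. For $\lambda\in\frac12\mathbb Z$ let $\mathcal F^\lambda$ be the complex vector space of meromorphic sections of $\mathcal K^\lambda:=L^{\otimes 2\lambda}$ which are holomorphic on $\Sigma\setminus A$; in a local coordinate $z$ such a section is $f(z)\,dz^\lambda$, and it is denoted by its local representing function $f$. Put $$[s\,dz^\lambda,t\,dz^\nu]:=(-\lambda s t'+\nu t s')\,dz^{\lambda+\nu+1},\qquad s\,dz^\lambda\cdot t\,dz^\nu:=st\,dz^{\lambda+\nu}.$$ Let $\mathcal S:=\mathcal L\oplus\mathcal F^{-1/2}$ with $\mathcal L:=\mathcal F^{-1}$ (meromorphic vector fields) even and $\mathcal F^{-1/2}$ odd, and with the bilinear bracket $$[(e,\varphi),(f,\psi)]:=([e,f]+\varphi\cdot\psi,\ e.\psi-f.\varphi),\qquad e.\psi:=[e,\psi]=(e\psi'-\tfrac12 e'\psi)\,dz^{-1/2}.$$ This is a Lie superalgebra: with parity $\bar x$, $[x,y]=-(-1)^{\bar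 x\bar y}[y,x]$ and $(-1)^{\bar x\bar z}[x,[y,z]]+(-1)^{\bar y\bar x}[y,[z,x]]+(-1)^{\bar z\bar y}[z,[x,y]]=0$ for homogeneous $x,y,z$. Let $R$ be a holomorphic projective connection, i.e. a system of holomorphic functions $R_\alpha(z_\alpha)$ for a covering by coordinates $z_\alpha$ with changes $z_\beta=h(z_\alpha)$, such that $R_\beta(z_\beta)\,(h')^2=R_\alpha(z_\alpha)+S(h)$, where $S(h)=\frac{h'''}{h'}-\frac32\left(\frac{h''}{h'}\right)^2$. Let $C$ be a closed continuously differentiable curve on $\Sigma$ not meeting $A$ (not necessarily connected: a finite family of such closed curves, the integral being the sum of the integrals). Then for $e,f\in\mathcal L$ and $\varphi,\psi\in\mathcal F^{-1/2}$ the local expressions $$\Big(\tfrac12(e'''f-ef''')-R\,(e'f-ef')\Big)dz,\qquad -\big(\varphi''\psi+\varphi\psi''-R\varphi\psi\big)dz$$ are well-defined meromorphic differentials on $\Sigma$, holomorphic outside $A$, their integrals over $C$ exist, and the bilinear extension $\Phi_{C,R}:\mathcal S\times\mathcal S\to\mathbb C$ of $$\Phi_{C,R}(e,f):=\int_C\Big(\tfrac12(e'''f-ef''')-R\,(e'f-ef')\Big)dz,$$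 $$\Phi_{C,R}(\varphi,\psi):=-\int_C\big(\varphi''\psi+\varphi\psi''-R\varphi\psi\big)dz,\qquad \Phi_{C,R}(e,\varphi):=\Phi_{C,R}(\varphi,e):=0$$ is an (even) Lie superalgebra 2-cocycle of $\mathcal S$: for homogeneous $x,y,z$ one has $\Phi(x,y)=-(-1)^{\bar x\bar y}\Phi(y,x)$ and $$(-1)^{\bar x\bar z}\Phi(x,[y,z])+(-1)^{\bar y\bar x}\Phi(y,[z,x])+(-1)^{\bar z\bar y}\Phi(z,[x,y])=0 .$$ Consequently $\mathbb C\oplus\mathcal S$ with bracket $[(a,x),(b,y)]:=(\Phi_{C,R}(x,y),[x,y])$ and even element $t=(1,0)$ is a Lie superalgebra, and is a central extension of $\mathcal S$ by the central element $t$. -/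

import Mathlib

open scoped Manifold ContDiff

noncomputable section

namespace KN

/-! ### Super vector spaces, Lie superalgebras, cocycles and central extensions -/

/-- The sign `(-1)^{a b}` for parities `a`, `b`. -/
def sgn (a b : ZMod 2) : ℂ := (-1) ^ (a.val * b.val)

/-- `V = V₀ ⊕ V₁` (with `V_a = P a`) with the bracket `br` is a complex Lie superalgebra. -/
structure IsLieSuperalgebra {V : Type*} [AddCommGroup V] [Module ℂ V]
    (P : ZMod 2 → Submodule ℂ V) (br : V →ₗ[ℂ] V →ₗ[ℂ] V) : Prop where
  isCompl : IsCompl (P 0) (P 1)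
  graded : ∀ a b, ∀ x ∈ P a, ∀ y ∈ P b, br x y ∈ P (a + b)
  skew : ∀ a b, ∀ x ∈ P a, ∀ y ∈ P b, br x y = -(sgn a b • br y x)
  jacobi : ∀ a b c, ∀ x ∈ P a, ∀ y ∈ P b, ∀ z ∈ P c,
    sgn a c • br x (br y z) + sgn b a • br y (br z x) + sgn c b • br z (br x y) = 0

/-- An even 2-cocycle of a Lie superalgebra with values in the trivial module `ℂ`
(the cocycles belonging to an even central element). -/
structure IsEvenCocycle {V : Type*} [AddCommGroup V] [Module ℂ V]
    (P : ZMod 2 → Submodule ℂ V) (br : V →ₗ[ℂ] V →ₗ[ℂ] V) (c : V →ₗ[ℂ] V →ₗ[ℂ] ℂ) : Prop where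
  even : ∀ a b, a ≠ b → ∀ x ∈ P a, ∀ y ∈ P b, c x y = 0
  skew : ∀ a b, ∀ x ∈ P a, ∀ y ∈ P b, c x y = -(sgn a b * c y x)
  cocycle : ∀ a b d, ∀ x ∈ P a, ∀ y ∈ P b, ∀ z ∈ P d,
    sgn a d * c x (br y z) + sgn b a * c y (br z x) + sgn d b * c z (br x y) = 0

/-- The parity decomposition of `ℂ ⊕ V`, in which the new element `t = (1, 0)` is even. -/
def extParity {V : Type*} [AddCommGroup V] [Module ℂ V] (P : ZMod 2 → Submodule ℂ V)
    (a : ZMod 2) : Submodule ℂ (ℂ × V) :=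
  Submodule.prod (if a = 0 then ⊤ else ⊥) (P a)

/-- The bracket `[(s, x), (s', y)] = (c x y, [x, y])` on `ℂ ⊕ V`. -/
def extBracket {V : Type*} [AddCommGroup V] [Module ℂ V]
    (br : V →ₗ[ℂ] V →ₗ[ℂ] V) (c : V →ₗ[ℂ] V →ₗ[ℂ] ℂ) :
    (ℂ × V) →ₗ[ℂ] (ℂ × V) →ₗ[ℂ] (ℂ × V) :=
  LinearMap.mk₂ ℂ (fun v w => (c v.2 w.2, br v.2 w.2))
    (by intros; simp) (by intros; simp) (by intros; simp) (by intros; simp)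

/-- `0 → ℂ → E → V → 0` (maps `i`, `p`) is a central extension of Lie superalgebras of
`(V, P, br)` by an even central element. -/
structure IsCentralExtension {V E : Type*} [AddCommGroup V] [Module ℂ V]
    [AddCommGroup E] [Module ℂ E]
    (P : ZMod 2 → Submodule ℂ V) (br : V →ₗ[ℂ] V →ₗ[ℂ] V)
    (Q : ZMod 2 → Submodule ℂ E) (brE : E →ₗ[ℂ] E →ₗ[ℂ] E)
    (i : ℂ →ₗ[ℂ] E) (p : E →ₗ[ℂ] V) : Prop where
  base : IsLieSuperalgebra P br
  total : IsLieSuperalgebra Q brE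
  injective : Function.Injective i
  surjective : Function.Surjective p
  exact : LinearMap.range i = LinearMap.ker p
  even_i : ∀ s, i s ∈ Q 0
  even_p : ∀ a, ∀ v ∈ Q a, p v ∈ P a
  hom : ∀ v w, p (brE v w) = br (p v) (p w)
  central : ∀ s v, brE (i s) v = 0 ∧ brE v (i s) = 0

/-! ### Coordinates, theta characteristics, projective connections -/

/-- A covering `(U_i, z_i)` of the Riemann surface `X` by holomorphic coordinates. -/
structure CoordCover (ι X : Type*) [TopologicalSpace X] [ChartedSpace ℂ X] where
  chart : ι → OpenPartialHomeomorph X ℂ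
  chart_mem : ∀ i, chart i ∈ IsManifold.maximalAtlas 𝓘(ℂ) ω X
  cover : ∀ x, ∃ i, x ∈ (chart i).source

section Coord

variable {ι X : Type*} [TopologicalSpace X] [ChartedSpace ℂ X]

/-- The coordinate change `z_j = z_j(z_i)`. -/
def CoordCover.change (U : CoordCover ι X) (j i : ι) : ℂ → ℂ :=
  fun z => U.chart j ((U.chart i).symm z)

/-- `U_i ∩ U_j` in the coordinate `z_i`. -/
def CoordCover.overlap (U : CoordCover ι X) (i j : ι) : Set ℂ :=
  {z | z ∈ (U.chart i).target ∧ (U.chart i).symm z ∈ (U.chart j).source}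

/-- `U_i ∖ A` in the coordinate `z_i`. -/
def CoordCover.punctured (U : CoordCover ι X) (A : Finset X) (i : ι) : Set ℂ :=
  {z | z ∈ (U.chart i).target ∧ (U.chart i).symm z ∉ A}

/-- A theta characteristic: a holomorphic line bundle `L` with `L ⊗ L = K`, given by
transition functions. With `s_i` the local frame of `L` over `U_i` for which `s_i ⊗ s_i = dz_i`,
`g j i` is the transition function `s_j = g_{ji} s_i`, written in the coordinate `z_i`; so `g j i`
is a square root of `dz_j / dz_i`. -/
structure ThetaChar (U : CoordCover ι X) where
  g : ι → ι → ℂ → ℂ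
  holo : ∀ i j, DifferentiableOn ℂ (g j i) (U.overlap i j)
  sq : ∀ i j, ∀ z ∈ U.overlap i j, g j i z ^ 2 = deriv (U.change j i) z
  cocycle : ∀ i j k, ∀ z ∈ U.overlap i j ∩ U.overlap i k,
    g k j (U.change j i z) * g j i z = g k i z

/-- The Schwarzian derivative `h'''/h' - (3/2) (h''/h')²`. -/
def schwarzian (h : ℂ → ℂ) (z : ℂ) : ℂ :=
  iteratedDeriv 3 h z / deriv h z - 3 / 2 * (iteratedDeriv 2 h z / deriv h z) ^ 2

/-- A holomorphic projective connection. -/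
structure ProjConn (U : CoordCover ι X) where
  R : ι → ℂ → ℂ
  holo : ∀ i, DifferentiableOn ℂ (R i) (U.chart i).target
  transform : ∀ i j, ∀ z ∈ U.overlap i j,
    R j (U.change j i z) * (deriv (U.change j i) z) ^ 2 = R i z + schwarzian (U.change j i) z

/-! ### Meromorphic forms of half-integer weight -/

/-- The space `F^λ`, `λ = n / 2`, of meromorphic sections of `L^{⊗ n}` which are holomorphic
outside `A`. A section is the system of its local representatives `f i`, written in the
coordinate `z_i`, so that it is `f_i (dz_i)^{n/2}` over `U_i`. The irrelevant values of the
functions `f i` at points outside `U_i ∖ A` are normalised to `0`. -/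
def forms (U : CoordCover ι X) (L : ThetaChar U) (A : Finset X) (n : ℤ) :
    Submodule ℂ (ι → ℂ → ℂ) where
  carrier := {f |
    (∀ i, ∀ z ∉ U.punctured A i, f i z = 0) ∧
    (∀ i, ∀ z ∈ U.punctured A i, DifferentiableAt ℂ (f i) z) ∧
    (∀ i, ∀ z ∈ (U.chart i).target, MeromorphicAt (f i) z) ∧
    (∀ i j, ∀ z ∈ U.overlap i j, (U.chart i).symm z ∉ A →
      f j (U.change j i z) = f i z * L.g j i z ^ (-n))}
  add_mem' := by
    rintro f g ⟨f1, f2, f3, f4⟩ ⟨g1, g2, g3, g4⟩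
    refine ⟨fun i z hz => ?_, fun i z hz => (f2 i z hz).add (g2 i z hz),
      fun i z hz => (f3 i z hz).add (g3 i z hz), fun i j z hz hA => ?_⟩
    · simp [f1 i z hz, g1 i z hz]
    · simp [f4 i j z hz hA, g4 i j z hz hA, add_mul]
  zero_mem' := by
    refine ⟨fun _ _ _ => rfl, fun _ z _ => differentiableAt_const (0 : ℂ),
      fun _ z _ => MeromorphicAt.const (0 : ℂ) z, fun _ _ _ _ _ => by simp⟩
  smul_mem' := by
    rintro c f ⟨f1, f2, f3, f4⟩
    refine ⟨fun i z hz => ?_, fun i z hz => (f2 i z hz).const_smul c,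
      fun i z hz => (MeromorphicAt.const c z).smul (f3 i z hz), fun i j z hz hA => ?_⟩
    · simp [f1 i z hz]
    · simp [f4 i j z hz hA, mul_assoc]

theorem CoordCover.overlap_self (U : CoordCover ι X) {i j : ι} {z : ℂ} (hz : z ∈ U.overlap i j) :
    z ∈ U.overlap i i := ⟨hz.1, (U.chart i).map_target hz.1⟩

theorem CoordCover.isOpen_overlap (U : CoordCover ι X) (i j : ι) : IsOpen (U.overlap i j) :=
  (U.chart i).symm.isOpen_inter_preimage (U.chart j).open_source

theorem CoordCover.change_mem_overlap (U : CoordCover ι X) {i j : ι} {z : ℂ}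
    (hz : z ∈ U.overlap i j) : U.change j i z ∈ U.overlap j i := by
  refine ⟨(U.chart j).map_source hz.2, ?_⟩
  simp only [CoordCover.change, (U.chart j).left_inv hz.2]
  exact (U.chart i).map_target hz.1

theorem CoordCover.isOpen_punctured [T1Space X] (U : CoordCover ι X) (A : Finset X) (i : ι) :
    IsOpen (U.punctured A i) :=
  (U.chart i).symm.isOpen_inter_preimage (A.finite_toSet.isClosed.isOpen_compl)

theorem CoordCover.change_mem_punctured (U : CoordCover ι X) {A : Finset X} {i j : ι} {z : ℂ}
    (hz : z ∈ U.overlap i j) (hA : (U.chart i).symm z ∉ A) :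
    U.change j i z ∈ U.punctured A j := by
  refine ⟨(U.change_mem_overlap hz).1, ?_⟩
  simpa only [CoordCover.change, (U.chart j).left_inv hz.2] using hA

theorem ThetaChar.ne_zero {U : CoordCover ι X} (L : ThetaChar U) {i j : ι} {z : ℂ}
    (hz : z ∈ U.overlap i j) : L.g j i z ≠ 0 := by
  have hii := U.overlap_self hz
  have h1 : deriv (U.change i i) z = 1 := by
    have : U.change i i =ᶠ[nhds z] id := by
      filter_upwards [(U.isOpen_overlap i i).mem_nhds hii] with w hw
      exact (U.chart i).right_inv hw.1
    rw [this.deriv_eq, deriv_id]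
  have h2 := L.sq i i z hii
  have h3 := L.cocycle i j i z ⟨hz, hii⟩
  rw [h1] at h2
  intro h0
  rw [h0, mul_zero] at h3
  rw [← h3] at h2
  norm_num at h2

theorem ThetaChar.hasDerivAt_change {U : CoordCover ι X} (L : ThetaChar U) {i j : ι} {z : ℂ}
    (hz : z ∈ U.overlap i j) : HasDerivAt (U.change j i) (L.g j i z ^ 2) z := by
  have h := L.sq i j z hz
  have : deriv (U.change j i) z ≠ 0 := by
    rw [← h]; exact pow_ne_zero 2 (L.ne_zero hz)
  rw [h]
  exact (differentiableAt_of_deriv_ne_zero this).hasDerivAt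

/-- The chain rule for the transformation law of forms. -/
theorem forms_deriv [T1Space X] {U : CoordCover ι X} {L : ThetaChar U} {A : Finset X} {n : ℤ}
    {f : ι → ℂ → ℂ} (hf : f ∈ forms U L A n) {i j : ι} {z : ℂ} (hz : z ∈ U.overlap i j)
    (hA : (U.chart i).symm z ∉ A) :
    deriv (f j) (U.change j i z) * L.g j i z ^ 2 =
      deriv (f i) z * L.g j i z ^ (-n) +
        f i z * ((-n : ℂ) * L.g j i z ^ (-n - 1) * deriv (L.g j i) z) := by
  obtain ⟨-, f2, -, f4⟩ := hf
  have hg0 := L.ne_zero hz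
  have hg : HasDerivAt (L.g j i) (deriv (L.g j i) z) z :=
    ((L.holo i j).differentiableAt ((U.isOpen_overlap i j).mem_nhds hz)).hasDerivAt
  have hL := ((f2 j _ (U.change_mem_punctured hz hA)).hasDerivAt.comp z (L.hasDerivAt_change hz))
  have hgn : HasDerivAt (fun w => L.g j i w ^ (-n))
      (((-n : ℤ) : ℂ) * L.g j i z ^ (-n - 1) * deriv (L.g j i) z) z :=
    (hasDerivAt_zpow (-n) (L.g j i z) (Or.inl hg0)).comp z hg
  have hR := (f2 i z ⟨hz.1, hA⟩).hasDerivAt.mul hgn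
  have heq : (f j ∘ U.change j i) =ᶠ[nhds z] (f i * fun w => L.g j i w ^ (-n)) := by
    filter_upwards [(U.isOpen_overlap i j).mem_nhds hz,
      (U.isOpen_punctured A i).mem_nhds ⟨hz.1, hA⟩] with w hw hwA
    exact f4 i j w hw hwA.2
  have := hL.unique (hR.congr_of_eventuallyEq heq)
  rw [this]
  push_cast
  ring

variable [T1Space X]

/-- The associative product `F^{m/2} × F^{n/2} → F^{k/2}`, `k = m + n`. -/
def formMul (U : CoordCover ι X) (L : ThetaChar U) (A : Finset X) (m n k : ℤ) (hk : k = m + n) :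
    forms U L A m →ₗ[ℂ] forms U L A n →ₗ[ℂ] forms U L A k :=
  LinearMap.mk₂ ℂ
    (fun s t => ⟨fun i z => s.1 i z * t.1 i z, by
      obtain ⟨s, s1, s2, s3, s4⟩ := s
      obtain ⟨t, t1, t2, t3, t4⟩ := t
      refine ⟨fun i z hz => ?_, fun i z hz => (s2 i z hz).mul (t2 i z hz),
        fun i z hz => (s3 i z hz).mul (t3 i z hz), fun i j z hz hA => ?_⟩
      · simp [s1 i z hz]
      · have h := zpow_add₀ (L.ne_zero hz) (-m) (-n)
        simp only [s4 i j z hz hA, t4 i j z hz hA]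
        rw [show -k = -m + -n by omega, h]
        ring⟩)
    (by intro _ _ _; ext i z; simp [add_mul])
    (by intro _ _ _; ext i z; simp [mul_assoc])
    (by intro _ _ _; ext i z; simp [mul_add])
    (by intro _ _ _; ext i z; simp; ring)

/-- The bracket `F^λ × F^ν → F^{λ+ν+1}`, `[s dz^λ, t dz^ν] = (-λ s t' + ν t s') dz^{λ+ν+1}`,
for `λ = m / 2`, `ν = n / 2`, `λ + ν + 1 = k / 2`. For `λ = -1` this is the Lie derivative; for
`λ = ν = -1` the Lie bracket of vector fields. -/
def formBracket (U : CoordCover ι X) (L : ThetaChar U) (A : Finset X) (m n k : ℤ)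
    (hk : k = m + n + 2) :
    forms U L A m →ₗ[ℂ] forms U L A n →ₗ[ℂ] forms U L A k :=
  LinearMap.mk₂ ℂ
    (fun s t => ⟨fun i z =>
        -(m / 2 : ℂ) * s.1 i z * deriv (t.1 i) z + (n / 2 : ℂ) * t.1 i z * deriv (s.1 i) z, by
      obtain ⟨s, hs⟩ := s
      obtain ⟨t, ht⟩ := t
      have ds := fun i j z => forms_deriv hs (i := i) (j := j) (z := z)
      have dt := fun i j z => forms_deriv ht (i := i) (j := j) (z := z)
      obtain ⟨s1, s2, s3, s4⟩ := hs
      obtain ⟨t1, t2, t3, t4⟩ := ht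
      have key : ∀ f : ι → ℂ → ℂ,
          (∀ i, ∀ z ∈ U.punctured A i, DifferentiableAt ℂ (f i) z) →
          ∀ i, ∀ z ∈ U.punctured A i, DifferentiableAt ℂ (deriv (f i)) z := by
        intro f hf i z hz
        have : DifferentiableOn ℂ (f i) (U.punctured A i) :=
          fun w hw => (hf i w hw).differentiableWithinAt
        exact (this.deriv (U.isOpen_punctured A i)).differentiableAt
          ((U.isOpen_punctured A i).mem_nhds hz)
      refine ⟨fun i z hz => ?_, fun i z hz => ?_, fun i z hz => ?_, fun i j z hz hA => ?_⟩
      · simp [s1 i z hz, t1 i z hz]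
      · exact (((s2 i z hz).const_mul _).mul (key t t2 i z hz)).add
          (((t2 i z hz).const_mul _).mul (key s s2 i z hz))
      · exact (((MeromorphicAt.const _ z).mul (s3 i z hz)).mul (t3 i z hz).deriv).add
          (((MeromorphicAt.const _ z).mul (t3 i z hz)).mul (s3 i z hz).deriv)
      · have hg0 := L.ne_zero hz
        have e1 := ds i j z hz hA
        have e2 := dt i j z hz hA
        apply mul_right_cancel₀ (pow_ne_zero 2 hg0)
        simp only [s4 i j z hz hA, t4 i j z hz hA]
        calc _ = -(m / 2 : ℂ) * (s i z * L.g j i z ^ (-m)) *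
                (deriv (t j) (U.change j i z) * L.g j i z ^ 2) +
              (n / 2 : ℂ) * (t i z * L.g j i z ^ (-n)) *
                (deriv (s j) (U.change j i z) * L.g j i z ^ 2) := by ring
          _ = _ := by
            rw [e1, e2, zpow_sub_one₀ hg0, zpow_sub_one₀ hg0, mul_assoc _ (L.g j i z ^ (-k)),
              show -k = -m + -n + (-2) by omega, zpow_add₀ hg0, zpow_add₀ hg0]
            simp only [zpow_neg, zpow_ofNat]
            field_simp
            ring⟩)
    (by
      intro s s' t; ext i z
      by_cases hz : z ∈ U.punctured A i
      · have : deriv (s.1 i + s'.1 i) z = deriv (s.1 i) z + deriv (s'.1 i) z :=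
          deriv_add (s.2.2.1 i z hz) (s'.2.2.1 i z hz)
        simp [this]; ring
      · simp [s.2.1 i z hz, s'.2.1 i z hz, t.2.1 i z hz])
    (by
      intro c s t; ext i z
      have : deriv (c • s.1 i) z = c • deriv (s.1 i) z := deriv_const_smul_field c (s.1 i)
      simp [this]; ring)
    (by
      intro s t t'; ext i z
      by_cases hz : z ∈ U.punctured A i
      · have : deriv (t.1 i + t'.1 i) z = deriv (t.1 i) z + deriv (t'.1 i) z :=
          deriv_add (t.2.2.1 i z hz) (t'.2.2.1 i z hz)
        simp [this]; ring
      · simp [t.2.1 i z hz, t'.2.1 i z hz, s.2.1 i z hz])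
    (by
      intro c s t; ext i z
      have : deriv (c • t.1 i) z = c • deriv (t.1 i) z := deriv_const_smul_field c (t.1 i)
      simp [this]; ring)

/-! ### The Krichever-Novikov Lie superalgebra -/

/-- The vector space `S = F^{-1} ⊕ F^{-1/2}`. -/
abbrev KNSuper (U : CoordCover ι X) (L : ThetaChar U) (A : Finset X) : Type _ :=
  forms U L A (-2) × forms U L A (-1)

/-- Vector fields are even, `-1/2`-forms are odd. -/
def parity (U : CoordCover ι X) (L : ThetaChar U) (A : Finset X) (a : ZMod 2) :
    Submodule ℂ (KNSuper U L A) :=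
  if a = 0 then Submodule.prod ⊤ ⊥ else Submodule.prod ⊥ ⊤

/-- The bracket `[(e, φ), (f, ψ)] = ([e, f] + φ ψ, e.ψ - f.φ)` of `S`. -/
def superBracket (U : CoordCover ι X) (L : ThetaChar U) (A : Finset X) :
    KNSuper U L A →ₗ[ℂ] KNSuper U L A →ₗ[ℂ] KNSuper U L A :=
  LinearMap.mk₂ ℂ
    (fun v w =>
      (formBracket U L A (-2) (-2) (-2) (by norm_num) v.1 w.1 +
          formMul U L A (-1) (-1) (-2) (by norm_num) v.2 w.2,
        formBracket U L A (-2) (-1) (-1) (by norm_num) v.1 w.2 -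
          formBracket U L A (-2) (-1) (-1) (by norm_num) w.1 v.2))
    (by intro _ _ _; ext1 <;> simp <;> abel)
    (by intro _ _ _; ext1 <;> simp [smul_sub])
    (by intro _ _ _; ext1 <;> simp <;> abel)
    (by intro _ _ _; ext1 <;> simp [smul_sub])

end Coord

/-! ### Curves and the integrals -/

section Curve

variable {ι X : Type*} [TopologicalSpace X] [ChartedSpace ℂ X]

/-- A closed continuously differentiable curve `[0, 1] → X` (only the values of `toFun`
on `[0, 1]` matter). -/
structure ClosedCurve (X : Type*) [TopologicalSpace X] [ChartedSpace ℂ X] where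
  toFun : ℝ → X
  contMDiffOn : ContMDiffOn 𝓘(ℝ, ℝ) 𝓘(ℝ, ℂ) 1 toFun (Set.Icc 0 1)
  closed : toFun 0 = toFun 1

/-- Some member of the covering containing `x`. -/
def CoordCover.index (U : CoordCover ι X) (x : X) : ι := (U.cover x).choose

/-- The pull-back under `C`, at the parameter `t`, of the differential which is `θ_i dz_i`
over `U_i`: it is `θ_i(z_i(C(t))) (z_i ∘ C)'(t)`, for any `i` with `C(t) ∈ U_i`
if `θ` is a well-defined differential. -/
def pullback (U : CoordCover ι X) (θ : ι → ℂ → ℂ) (C : ClosedCurve X) (t : ℝ) : ℂ :=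
  θ (U.index (C.toFun t)) (U.chart (U.index (C.toFun t)) (C.toFun t)) *
    deriv (fun s : ℝ => U.chart (U.index (C.toFun t)) (C.toFun s)) t

/-- `∮_C θ`. -/
def curveIntegral (U : CoordCover ι X) (θ : ι → ℂ → ℂ) (C : ClosedCurve X) : ℂ :=
  ∫ t in (0 : ℝ)..1, pullback U θ C t

/-- `½ (e''' f - e f''') - R (e' f - e f')`, in the coordinate `z_i`. -/
def evenIntegrand {U : CoordCover ι X} (R : ProjConn U) (e f : ι → ℂ → ℂ) : ι → ℂ → ℂ :=
  fun i z => 1 / 2 * (iteratedDeriv 3 (e i) z * f i z - e i z * iteratedDeriv 3 (f i) z) -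
    R.R i z * (deriv (e i) z * f i z - e i z * deriv (f i) z)

/-- `-(φ'' ψ + φ ψ'' - R φ ψ)`, in the coordinate `z_i`. -/
def oddIntegrand {U : CoordCover ι X} (R : ProjConn U) (φ ψ : ι → ℂ → ℂ) : ι → ℂ → ℂ :=
  fun i z => -(iteratedDeriv 2 (φ i) z * ψ i z + φ i z * iteratedDeriv 2 (ψ i) z -
    R.R i z * φ i z * ψ i z)

end Curve

end KN

end

noncomputable section

namespace KN

/-! ### Central extensions defined by cocycles -/

section Super

/-! Write `g` for the transition function of `L`, so that a coordinate change `h` has `h' = g²`, and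
put `u = g'/g`. Then `S(h) = 2u' - 2u²`. A vector field `b` becomes `a` with `a''' g⁴ = b''' + 2 S
b' + S' b`, and a form of weight `-1/2` becomes `a` with `a'' g³ = b'' + ½ S b`. In the even
integrand the `S'` terms cancel by antisymmetry; the `S` terms left in either integrand are absorbed
by the inhomogeneous transformation of `R`. Hence both integrands are differentials
(`evenIntegrand_mem`, `oddIntegrand_mem`).

In the cocycle identities `R` cancels pointwise, and the rest is exact. For three vector fields it
is `-½ dW`, with `W` the Wronskian. For one vector field and two spinors it is `dF` with `F` an
explicit bidifferential expression in the 2-jets. Both primitives have total weight zero and are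
genuine functions on `Σ ∖ A`, so the integral over a closed curve vanishes
(`curveIntegral_eq_zero_of_exact`). The remaining parity types hold because the form is even.

The Lie superalgebra axioms are pointwise identities in the jets, and the axioms of the extension
are those of `S` together with those of the cocycle. -/

theorem zmod_two_cases (a : ZMod 2) : a = 0 ∨ a = 1 := by
  fin_cases a
  · exact Or.inl rfl
  · exact Or.inr rfl

@[simp] theorem sgn_zero_left (a : ZMod 2) : sgn 0 a = 1 := by simp [sgn]

@[simp] theorem sgn_zero_right (a : ZMod 2) : sgn a 0 = 1 := by simp [sgn]

@[simp] theorem sgn_one_one : sgn 1 1 = -1 := by simp [sgn, ZMod.val_one]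

variable {V : Type*} [AddCommGroup V] [Module ℂ V] {P : ZMod 2 → Submodule ℂ V}
  {br : V →ₗ[ℂ] V →ₗ[ℂ] V} {c : V →ₗ[ℂ] V →ₗ[ℂ] ℂ}

@[simp] theorem extBracket_apply (v w : ℂ × V) :
    extBracket br c v w = (c v.2 w.2, br v.2 w.2) := rfl

theorem mem_extParity {a : ZMod 2} {v : ℂ × V} :
    v ∈ extParity P a ↔ (a ≠ 0 → v.1 = 0) ∧ v.2 ∈ P a := by
  unfold extParity
  split_ifs with h <;> simp [h, Submodule.mem_prod]

theorem isCompl_prod {W : Type*} [AddCommGroup W] [Module ℂ W] {p p' : Submodule ℂ V}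
    {q q' : Submodule ℂ W} (hp : IsCompl p p') (hq : IsCompl q q') :
    IsCompl (p.prod q) (p'.prod q') := by
  constructor
  · rw [disjoint_iff, Submodule.prod_inf_prod, hp.inf_eq_bot, hq.inf_eq_bot, Submodule.prod_bot]
  · rw [codisjoint_iff, Submodule.prod_sup_prod, hp.sup_eq_top, hq.sup_eq_top, Submodule.prod_top]

/-- The bracket ignores the central coordinates. The second component of each axiom is therefore the
axiom for `V`, and the first is the matching condition on `c`; evenness of `c` is what makes the
bracket graded. -/
theorem IsEvenCocycle.isLieSuperalgebra_extBracket (hV : IsLieSuperalgebra P br)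
    (hc : IsEvenCocycle P br c) : IsLieSuperalgebra (extParity P) (extBracket br c) where
  isCompl := by
    simpa [extParity] using isCompl_prod (isCompl_top_bot (α := Submodule ℂ ℂ)) hV.isCompl
  graded a b x hx y hy := by
    rw [mem_extParity] at hx hy ⊢
    refine ⟨fun hab => hc.even a b ?_ _ hx.2 _ hy.2, hV.graded a b _ hx.2 _ hy.2⟩
    -- Equal parities add up to `0`, where the central coordinate is unrestricted.
    rintro rfl
    exact hab (CharTwo.add_self_eq_zero a)
  skew a b x hx y hy := by
    rw [mem_extParity] at hx hy
    ext1
    · simpa using hc.skew a b _ hx.2 _ hy.2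
    · simpa using hV.skew a b _ hx.2 _ hy.2
  jacobi a b d x hx y hy z hz := by
    rw [mem_extParity] at hx hy hz
    ext1
    · simpa using hc.cocycle a b d _ hx.2 _ hy.2 _ hz.2
    · simpa using hV.jacobi a b d _ hx.2 _ hy.2 _ hz.2

theorem IsEvenCocycle.isCentralExtension (hV : IsLieSuperalgebra P br)
    (hc : IsEvenCocycle P br c) :
    IsCentralExtension P br (extParity P) (extBracket br c)
      (LinearMap.inl ℂ ℂ V) (LinearMap.snd ℂ ℂ V) where
  base := hV
  total := hc.isLieSuperalgebra_extBracket hV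
  injective := LinearMap.inl_injective
  surjective := LinearMap.snd_surjective
  exact := LinearMap.range_inl ℂ ℂ V
  even_i s := by simp [mem_extParity]
  even_p a v hv := (mem_extParity.1 hv).2
  hom v w := rfl
  central s v := by simp

/-- A cyclically invariant condition on homogeneous triples has to be checked only up to cyclic
permutations. -/
theorem parity_cyclic_induction {Q : ZMod 2 → ZMod 2 → ZMod 2 → V → V → V → Prop}
    (hQ : ∀ a b d x y z, Q a b d x y z → Q b d a y z x)
    (h000 : ∀ x ∈ P 0, ∀ y ∈ P 0, ∀ z ∈ P 0, Q 0 0 0 x y z)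
    (h001 : ∀ x ∈ P 0, ∀ y ∈ P 0, ∀ z ∈ P 1, Q 0 0 1 x y z)
    (h011 : ∀ x ∈ P 0, ∀ y ∈ P 1, ∀ z ∈ P 1, Q 0 1 1 x y z)
    (h111 : ∀ x ∈ P 1, ∀ y ∈ P 1, ∀ z ∈ P 1, Q 1 1 1 x y z) :
    ∀ a b d, ∀ x ∈ P a, ∀ y ∈ P b, ∀ z ∈ P d, Q a b d x y z := by
  intro a b d x hx y hy z hz
  rcases zmod_two_cases a with rfl | rfl <;> rcases zmod_two_cases b with rfl | rfl <;>
    rcases zmod_two_cases d with rfl | rfl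
  · exact h000 x hx y hy z hz
  · exact h001 x hx y hy z hz
  · exact hQ _ _ _ _ _ _ (h001 z hz x hx y hy)
  · exact h011 x hx y hy z hz
  · exact hQ _ _ _ _ _ _ (hQ _ _ _ _ _ _ (h001 y hy z hz x hx))
  · exact hQ _ _ _ _ _ _ (hQ _ _ _ _ _ _ (h011 y hy z hz x hx))
  · exact hQ _ _ _ _ _ _ (h011 z hz x hx y hy)
  · exact h111 x hx y hy z hz

end Super

/-! ### Jets of local representatives under coordinate changes -/

section Jets

theorem analyticAt_iteratedDeriv {f : ℂ → ℂ} {z : ℂ} (hf : AnalyticAt ℂ f z) (k : ℕ) :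
    AnalyticAt ℂ (iteratedDeriv k f) z := by
  rw [iteratedDeriv_eq_iterate]
  exact hf.iterated_deriv k

theorem hasDerivAt_iteratedDeriv {f : ℂ → ℂ} {z : ℂ} (hf : AnalyticAt ℂ f z) (k : ℕ) :
    HasDerivAt (iteratedDeriv k f) (iteratedDeriv (k + 1) f z) z := by
  rw [iteratedDeriv_succ]
  exact (analyticAt_iteratedDeriv hf k).differentiableAt.hasDerivAt

theorem hasDerivAt_deriv {f : ℂ → ℂ} {z : ℂ} (hf : AnalyticAt ℂ f z) :
    HasDerivAt (deriv f) (iteratedDeriv 2 f z) z := by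
  simpa only [iteratedDeriv_one] using hasDerivAt_iteratedDeriv hf 1

variable {S : Set ℂ} {a c g h : ℂ → ℂ} {z : ℂ}

/-- Differentiation of a transformation law `a ∘ h = c` when `h' = g²`. -/
theorem deriv_change (hS : IsOpen S) (hh : ∀ w ∈ S, HasDerivAt h (g w ^ 2) w)
    (ha : ∀ w ∈ S, AnalyticAt ℂ a (h w)) (hac : ∀ w ∈ S, a (h w) = c w) (hz : z ∈ S) {c' : ℂ}
    (hc : HasDerivAt c c' z) : deriv a (h z) * g z ^ 2 = c' := by
  have h1 := (ha z hz).differentiableAt.hasDerivAt.comp z (hh z hz)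
  refine h1.unique (hc.congr_of_eventuallyEq ?_)
  filter_upwards [hS.mem_nhds hz] with w hw using hac w hw

/-- The logarithmic derivative of the transition function of `L`. -/
def logD (g : ℂ → ℂ) : ℂ → ℂ := fun z => deriv g z / g z

theorem deriv_eq_logD_mul (h0 : g z ≠ 0) : deriv g z = logD g z * g z := by
  rw [logD, div_mul_cancel₀ _ h0]

theorem analyticAt_logD (hg : AnalyticAt ℂ g z) (h0 : g z ≠ 0) : AnalyticAt ℂ (logD g) z :=
  hg.deriv.fun_div hg h0

theorem hasDerivAt_transition (hg : AnalyticAt ℂ g z) (h0 : g z ≠ 0) :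
    HasDerivAt g (logD g z * g z) z := by
  rw [← deriv_eq_logD_mul h0]
  exact hg.differentiableAt.hasDerivAt

theorem hasDerivAt_logD (hg : AnalyticAt ℂ g z) (h0 : g z ≠ 0) :
    HasDerivAt (logD g) (deriv (logD g) z) z :=
  (analyticAt_logD hg h0).differentiableAt.hasDerivAt

/-- From `h' = g²` one gets `h''/h' = 2u` with `u = g'/g`; insert this in `S(h) = (h''/h')' - ½
(h''/h')²`. -/
theorem schwarzian_eq_logD (hS : IsOpen S) (hh : ∀ w ∈ S, HasDerivAt h (g w ^ 2) w)
    (hg : ∀ w ∈ S, AnalyticAt ℂ g w) (h0 : ∀ w ∈ S, g w ≠ 0) (hz : z ∈ S) :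
    schwarzian h z = 2 * deriv (logD g) z - 2 * logD g z ^ 2 := by
  have d1 : ∀ w ∈ S, deriv h w = g w ^ 2 := fun w hw => (hh w hw).deriv
  have d2 : ∀ w ∈ S, iteratedDeriv 2 h w = 2 * logD g w * g w ^ 2 := by
    intro w hw
    rw [iteratedDeriv_succ, iteratedDeriv_one]
    have := (hasDerivAt_transition (hg w hw) (h0 w hw)).fun_pow 2
    have e : deriv h =ᶠ[nhds w] fun w => g w ^ 2 := by
      filter_upwards [hS.mem_nhds hw] with v hv using d1 v hv
    rw [(this.congr_of_eventuallyEq e).deriv]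
    ring
  have d3 : iteratedDeriv 3 h z =
      2 * deriv (logD g) z * g z ^ 2 + 4 * logD g z ^ 2 * g z ^ 2 := by
    rw [iteratedDeriv_succ]
    have := ((hasDerivAt_logD (hg z hz) (h0 z hz)).const_mul 2).fun_mul
      ((hasDerivAt_transition (hg z hz) (h0 z hz)).fun_pow 2)
    have e : iteratedDeriv 2 h =ᶠ[nhds z] fun w => 2 * logD g w * g w ^ 2 := by
      filter_upwards [hS.mem_nhds hz] with v hv using d2 v hv
    rw [(this.congr_of_eventuallyEq e).deriv]
    ring
  have := h0 z hz
  rw [schwarzian, d1 z hz, d2 z hz, d3]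
  field_simp
  ring

variable {b : ℂ → ℂ}

theorem vector_deriv_one (hS : IsOpen S) (hh : ∀ w ∈ S, HasDerivAt h (g w ^ 2) w)
    (hg : ∀ w ∈ S, AnalyticAt ℂ g w) (h0 : ∀ w ∈ S, g w ≠ 0)
    (ha : ∀ w ∈ S, AnalyticAt ℂ a (h w)) (hb : ∀ w ∈ S, AnalyticAt ℂ b w)
    (hab : ∀ w ∈ S, a (h w) = b w * g w ^ 2) (hz : z ∈ S) :
    deriv a (h z) = deriv b z + 2 * (logD g z * b z) := by
  have := deriv_change hS hh ha hab hz ((hb z hz).differentiableAt.hasDerivAt.fun_mul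
    ((hasDerivAt_transition (hg z hz) (h0 z hz)).fun_pow 2))
  apply mul_right_cancel₀ (pow_ne_zero 2 (h0 z hz))
  rw [this]
  ring

theorem vector_deriv_two (hS : IsOpen S) (hh : ∀ w ∈ S, HasDerivAt h (g w ^ 2) w)
    (hg : ∀ w ∈ S, AnalyticAt ℂ g w) (h0 : ∀ w ∈ S, g w ≠ 0)
    (ha : ∀ w ∈ S, AnalyticAt ℂ a (h w)) (hb : ∀ w ∈ S, AnalyticAt ℂ b w)
    (hab : ∀ w ∈ S, a (h w) = b w * g w ^ 2) (hz : z ∈ S) :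
    iteratedDeriv 2 a (h z) * g z ^ 2 =
      iteratedDeriv 2 b z + 2 * (deriv (logD g) z * b z + logD g z * deriv b z) := by
  rw [iteratedDeriv_succ, iteratedDeriv_one]
  exact deriv_change hS hh (fun w hw => (ha w hw).deriv)
    (fun w hw => vector_deriv_one hS hh hg h0 ha hb hab hw) hz
    ((hasDerivAt_deriv (hb z hz)).fun_add (((hasDerivAt_logD (hg z hz) (h0 z hz)).fun_mul
      (hb z hz).differentiableAt.hasDerivAt).const_mul 2))

/-- The second derivative of `b` has dropped out, and the coefficients of `b'` and `b` are `2 S(h)`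
and `S(h)'`. Thus only the Schwarzian obstructs the covariance of the third derivative. -/
theorem vector_deriv_three (hS : IsOpen S) (hh : ∀ w ∈ S, HasDerivAt h (g w ^ 2) w)
    (hg : ∀ w ∈ S, AnalyticAt ℂ g w) (h0 : ∀ w ∈ S, g w ≠ 0)
    (ha : ∀ w ∈ S, AnalyticAt ℂ a (h w)) (hb : ∀ w ∈ S, AnalyticAt ℂ b w)
    (hab : ∀ w ∈ S, a (h w) = b w * g w ^ 2) (hz : z ∈ S) :
    iteratedDeriv 3 a (h z) * g z ^ 4 =
      iteratedDeriv 3 b z + 4 * (deriv (logD g) z - logD g z ^ 2) * deriv b z +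
        2 * (iteratedDeriv 2 (logD g) z - 2 * logD g z * deriv (logD g) z) * b z := by
  -- `deriv_change` needs a law solved for `a'' ∘ h`, hence the division by `g²`.
  have e2 : ∀ w ∈ S, iteratedDeriv 2 a (h w) =
      (iteratedDeriv 2 b w + 2 * (deriv (logD g) w * b w + logD g w * deriv b w)) / g w ^ 2 :=
    fun w hw => by
      rw [eq_div_iff (pow_ne_zero 2 (h0 w hw)), vector_deriv_two hS hh hg h0 ha hb hab hw]
  have hb' := (hb z hz).differentiableAt.hasDerivAt
  have hb2 := hasDerivAt_deriv (hb z hz)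
  have hu := hasDerivAt_logD (hg z hz) (h0 z hz)
  have hu2 := hasDerivAt_deriv (analyticAt_logD (hg z hz) (h0 z hz))
  have := deriv_change hS hh (fun w hw => analyticAt_iteratedDeriv (ha w hw) 2) e2 hz
    (((hasDerivAt_iteratedDeriv (hb z hz) 2).fun_add
      (((hu2.fun_mul hb').fun_add (hu.fun_mul hb2)).const_mul 2)).fun_div
      ((hasDerivAt_transition (hg z hz) (h0 z hz)).fun_pow 2) (pow_ne_zero 2 (h0 z hz)))
  have h00 := h0 z hz
  rw [show iteratedDeriv 3 a (h z) * g z ^ 4 =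
    iteratedDeriv 3 a (h z) * g z ^ 2 * g z ^ 2 by ring, iteratedDeriv_succ (n := 2) (f := a), this]
  field_simp
  ring

theorem spinor_deriv_one (hS : IsOpen S) (hh : ∀ w ∈ S, HasDerivAt h (g w ^ 2) w)
    (hg : ∀ w ∈ S, AnalyticAt ℂ g w) (h0 : ∀ w ∈ S, g w ≠ 0)
    (ha : ∀ w ∈ S, AnalyticAt ℂ a (h w)) (hb : ∀ w ∈ S, AnalyticAt ℂ b w)
    (hab : ∀ w ∈ S, a (h w) = b w * g w) (hz : z ∈ S) :
    deriv a (h z) * g z = deriv b z + logD g z * b z := by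
  have := deriv_change hS hh ha hab hz ((hb z hz).differentiableAt.hasDerivAt.fun_mul
    (hasDerivAt_transition (hg z hz) (h0 z hz)))
  apply mul_right_cancel₀ (h0 z hz)
  rw [mul_assoc, ← sq, this]
  ring

/-- Weight `-1/2` is the one for which the first-order term cancels in the second derivative; what
remains is `½ S(h) b`. -/
theorem spinor_deriv_two (hS : IsOpen S) (hh : ∀ w ∈ S, HasDerivAt h (g w ^ 2) w)
    (hg : ∀ w ∈ S, AnalyticAt ℂ g w) (h0 : ∀ w ∈ S, g w ≠ 0)
    (ha : ∀ w ∈ S, AnalyticAt ℂ a (h w)) (hb : ∀ w ∈ S, AnalyticAt ℂ b w)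
    (hab : ∀ w ∈ S, a (h w) = b w * g w) (hz : z ∈ S) :
    iteratedDeriv 2 a (h z) * g z ^ 3 =
      iteratedDeriv 2 b z + (deriv (logD g) z - logD g z ^ 2) * b z := by
  have e1 : ∀ w ∈ S, deriv a (h w) = (deriv b w + logD g w * b w) / g w := fun w hw => by
    rw [eq_div_iff (h0 w hw), spinor_deriv_one hS hh hg h0 ha hb hab hw]
  have := deriv_change hS hh (fun w hw => (ha w hw).deriv) e1 hz
    (((hasDerivAt_deriv (hb z hz)).fun_add ((hasDerivAt_logD (hg z hz) (h0 z hz)).fun_mul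
      (hb z hz).differentiableAt.hasDerivAt)).fun_div
      (hasDerivAt_transition (hg z hz) (h0 z hz)) (h0 z hz))
  have h00 := h0 z hz
  rw [show iteratedDeriv 2 a (h z) * g z ^ 3 =
    iteratedDeriv 2 a (h z) * g z ^ 2 * g z by ring, iteratedDeriv_succ, iteratedDeriv_one, this]
  field_simp
  ring

end Jets

/-! ### Forms as local analytic functions -/

section Forms

variable {ι X : Type*} [TopologicalSpace X] [ChartedSpace ℂ X]
  {U : CoordCover ι X} {L : ThetaChar U} {A : Finset X} {n : ℤ} {f : ι → ℂ → ℂ} {i j : ι} {z : ℂ}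

theorem forms_eq_zero (hf : f ∈ forms U L A n) (hz : z ∉ U.punctured A i) : f i z = 0 :=
  hf.1 i z hz

theorem forms_meromorphicAt_iteratedDeriv (hf : f ∈ forms U L A n) (hz : z ∈ (U.chart i).target)
    (k : ℕ) : MeromorphicAt (iteratedDeriv k (f i)) z := by
  rw [iteratedDeriv_eq_iterate]
  exact (hf.2.2.1 i z hz).iterated_deriv

/-- Representatives are normalised to `0` elsewhere. Identities between forms thus need checking
only where everything is analytic and the derivative rules apply. -/
theorem forms_ext {s t : forms U L A n} (h : ∀ i, ∀ z ∈ U.punctured A i, s.1 i z = t.1 i z) :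
    s = t := by
  ext i z
  by_cases hz : z ∈ U.punctured A i
  · exact h i z hz
  · rw [forms_eq_zero s.2 hz, forms_eq_zero t.2 hz]

theorem ThetaChar.analyticAt (L : ThetaChar U) (hz : z ∈ U.overlap i j) :
    AnalyticAt ℂ (L.g j i) z :=
  (L.holo i j).analyticAt ((U.isOpen_overlap i j).mem_nhds hz)

theorem ProjConn.analyticAt (R : ProjConn U) (hz : z ∈ (U.chart i).target) :
    AnalyticAt ℂ (R.R i) z :=
  (R.holo i).analyticAt ((U.chart i).open_target.mem_nhds hz)

/-- `U_i ∩ U_j ∖ A` in the coordinate `z_i`. -/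
def CoordCover.puncturedOverlap (U : CoordCover ι X) (A : Finset X) (i j : ι) : Set ℂ :=
  U.overlap i j ∩ U.punctured A i

theorem ProjConn.transform_logD (R : ProjConn U) (L : ThetaChar U) (hz : z ∈ U.overlap i j) :
    R.R j (U.change j i z) * L.g j i z ^ 4 =
      R.R i z + 2 * deriv (logD (L.g j i)) z - 2 * logD (L.g j i) z ^ 2 := by
  have := R.transform i j z hz
  rw [schwarzian_eq_logD (U.isOpen_overlap i j) (fun w hw => L.hasDerivAt_change hw)
    (fun w hw => L.analyticAt hw) (fun w hw => L.ne_zero hw) hz, ← L.sq i j z hz] at this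
  linear_combination this

theorem vector_change (hf : f ∈ forms U L A (-2)) (hz : z ∈ U.puncturedOverlap A i j) :
    f j (U.change j i z) = f i z * L.g j i z ^ 2 := by
  rw [hf.2.2.2 i j z hz.1 hz.2.2, neg_neg, zpow_ofNat]

theorem spinor_change (hf : f ∈ forms U L A (-1)) (hz : z ∈ U.puncturedOverlap A i j) :
    f j (U.change j i z) = f i z * L.g j i z := by
  rw [hf.2.2.2 i j z hz.1 hz.2.2, neg_neg, zpow_one]

variable [T1Space X]

theorem forms_analyticAt (hf : f ∈ forms U L A n) (hz : z ∈ U.punctured A i) :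
    AnalyticAt ℂ (f i) z :=
  DifferentiableOn.analyticAt (s := U.punctured A i)
    (fun w hw => (hf.2.1 i w hw).differentiableWithinAt) ((U.isOpen_punctured A i).mem_nhds hz)

theorem CoordCover.isOpen_puncturedOverlap (U : CoordCover ι X) (A : Finset X) (i j : ι) :
    IsOpen (U.puncturedOverlap A i j) :=
  (U.isOpen_overlap i j).inter (U.isOpen_punctured A i)

theorem forms_analyticAt_change (hf : f ∈ forms U L A n) (hz : z ∈ U.puncturedOverlap A i j) :
    AnalyticAt ℂ (f j) (U.change j i z) :=
  forms_analyticAt hf (U.change_mem_punctured hz.1 hz.2.2)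

/-- The jets of a vector field in two coordinates. -/
theorem vector_jet (hf : f ∈ forms U L A (-2)) (hz : z ∈ U.puncturedOverlap A i j) :
    f j (U.change j i z) = f i z * L.g j i z ^ 2 ∧
    deriv (f j) (U.change j i z) = deriv (f i) z + 2 * (logD (L.g j i) z * f i z) ∧
    iteratedDeriv 2 (f j) (U.change j i z) * L.g j i z ^ 2 = iteratedDeriv 2 (f i) z +
      2 * (deriv (logD (L.g j i)) z * f i z + logD (L.g j i) z * deriv (f i) z) ∧
    iteratedDeriv 3 (f j) (U.change j i z) * L.g j i z ^ 4 = iteratedDeriv 3 (f i) z +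
      4 * (deriv (logD (L.g j i)) z - logD (L.g j i) z ^ 2) * deriv (f i) z +
      2 * (iteratedDeriv 2 (logD (L.g j i)) z -
        2 * logD (L.g j i) z * deriv (logD (L.g j i)) z) * f i z := by
  have hS := U.isOpen_puncturedOverlap A i j
  have hh : ∀ w ∈ U.puncturedOverlap A i j, HasDerivAt (U.change j i) (L.g j i w ^ 2) w :=
    fun w hw => L.hasDerivAt_change hw.1
  have hg : ∀ w ∈ U.puncturedOverlap A i j, AnalyticAt ℂ (L.g j i) w :=
    fun w hw => L.analyticAt hw.1
  have h0 : ∀ w ∈ U.puncturedOverlap A i j, L.g j i w ≠ 0 := fun w hw => L.ne_zero hw.1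
  have ha := fun w hw => forms_analyticAt_change hf (i := i) (j := j) (z := w) hw
  have hb : ∀ w ∈ U.puncturedOverlap A i j, AnalyticAt ℂ (f i) w :=
    fun w hw => forms_analyticAt hf hw.2
  have hab := fun w hw => vector_change hf (i := i) (j := j) (z := w) hw
  exact ⟨hab z hz, vector_deriv_one hS hh hg h0 ha hb hab hz,
    vector_deriv_two hS hh hg h0 ha hb hab hz, vector_deriv_three hS hh hg h0 ha hb hab hz⟩

/-- The jets of a form of weight `-1/2` in two coordinates. -/
theorem spinor_jet (hf : f ∈ forms U L A (-1)) (hz : z ∈ U.puncturedOverlap A i j) :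
    f j (U.change j i z) = f i z * L.g j i z ∧
    deriv (f j) (U.change j i z) * L.g j i z = deriv (f i) z + logD (L.g j i) z * f i z ∧
    iteratedDeriv 2 (f j) (U.change j i z) * L.g j i z ^ 3 = iteratedDeriv 2 (f i) z +
      (deriv (logD (L.g j i)) z - logD (L.g j i) z ^ 2) * f i z := by
  have hS := U.isOpen_puncturedOverlap A i j
  have hh : ∀ w ∈ U.puncturedOverlap A i j, HasDerivAt (U.change j i) (L.g j i w ^ 2) w :=
    fun w hw => L.hasDerivAt_change hw.1
  have hg : ∀ w ∈ U.puncturedOverlap A i j, AnalyticAt ℂ (L.g j i) w :=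
    fun w hw => L.analyticAt hw.1
  have h0 : ∀ w ∈ U.puncturedOverlap A i j, L.g j i w ≠ 0 := fun w hw => L.ne_zero hw.1
  have ha := fun w hw => forms_analyticAt_change hf (i := i) (j := j) (z := w) hw
  have hb : ∀ w ∈ U.puncturedOverlap A i j, AnalyticAt ℂ (f i) w :=
    fun w hw => forms_analyticAt hf hw.2
  have hab := fun w hw => spinor_change hf (i := i) (j := j) (z := w) hw
  exact ⟨hab z hz, spinor_deriv_one hS hh hg h0 ha hb hab hz,
    spinor_deriv_two hS hh hg h0 ha hb hab hz⟩

theorem evenIntegrand_mem (R : ProjConn U) {e f : ι → ℂ → ℂ} (he : e ∈ forms U L A (-2))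
    (hf : f ∈ forms U L A (-2)) : evenIntegrand R e f ∈ forms U L A 2 := by
  refine ⟨fun i z hz => ?_, fun i z hz => AnalyticAt.differentiableAt ?_, fun i z hz => ?_,
    fun i j z hz hA => ?_⟩
  · simp [evenIntegrand, forms_eq_zero he hz, forms_eq_zero hf hz]
  · have ae := forms_analyticAt he hz
    have af := forms_analyticAt hf hz
    exact (analyticAt_const.mul (((analyticAt_iteratedDeriv ae 3).mul af).sub
      (ae.mul (analyticAt_iteratedDeriv af 3)))).sub
      ((R.analyticAt hz.1).mul ((ae.deriv.mul af).sub (ae.mul af.deriv)))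
  · have me := he.2.2.1 i z hz
    have mf := hf.2.2.1 i z hz
    exact ((MeromorphicAt.const _ z).mul (((forms_meromorphicAt_iteratedDeriv he hz 3).mul mf).sub
      (me.mul (forms_meromorphicAt_iteratedDeriv hf hz 3)))).sub
      ((R.analyticAt hz).meromorphicAt.mul ((me.deriv.mul mf).sub (me.mul mf.deriv)))
  · have hz' : z ∈ U.puncturedOverlap A i j := ⟨hz, hz.1, hA⟩
    have hg := L.ne_zero hz
    obtain ⟨e0, e1, -, e3⟩ := vector_jet he hz'
    obtain ⟨f0, f1, -, f3⟩ := vector_jet hf hz'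
    have hR := R.transform_logD L hz
    rw [zpow_neg, zpow_ofNat, ← div_eq_mul_inv, eq_div_iff (pow_ne_zero 2 hg)]
    simp only [evenIntegrand]
    rw [e0, f0, e1, f1]
    -- The `S'` terms of `e3` and `f3` cancel by antisymmetry, and `hR` removes the Schwarzian
    -- multiple of `e' f - e f'`.
    linear_combination (1 / 2 * f i z) * e3 - (1 / 2 * e i z) * f3 -
      (deriv (e i) z * f i z - e i z * deriv (f i) z) * hR

theorem oddIntegrand_mem (R : ProjConn U) {φ ψ : ι → ℂ → ℂ} (hφ : φ ∈ forms U L A (-1))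
    (hψ : ψ ∈ forms U L A (-1)) : oddIntegrand R φ ψ ∈ forms U L A 2 := by
  refine ⟨fun i z hz => ?_, fun i z hz => AnalyticAt.differentiableAt ?_, fun i z hz => ?_,
    fun i j z hz hA => ?_⟩
  · simp [oddIntegrand, forms_eq_zero hφ hz, forms_eq_zero hψ hz]
  · have ae := forms_analyticAt hφ hz
    have af := forms_analyticAt hψ hz
    exact ((((analyticAt_iteratedDeriv ae 2).mul af).add
      (ae.mul (analyticAt_iteratedDeriv af 2))).sub
      (((R.analyticAt hz.1).mul ae).mul af)).neg
  · have me := hφ.2.2.1 i z hz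
    have mf := hψ.2.2.1 i z hz
    exact ((((forms_meromorphicAt_iteratedDeriv hφ hz 2).mul mf).add
      (me.mul (forms_meromorphicAt_iteratedDeriv hψ hz 2))).sub
      (((R.analyticAt hz).meromorphicAt.mul me).mul mf)).neg
  · have hz' : z ∈ U.puncturedOverlap A i j := ⟨hz, hz.1, hA⟩
    have hg := L.ne_zero hz
    obtain ⟨e0, -, e2⟩ := spinor_jet hφ hz'
    obtain ⟨f0, -, f2⟩ := spinor_jet hψ hz'
    have hR := R.transform_logD L hz
    rw [zpow_neg, zpow_ofNat, ← div_eq_mul_inv, eq_div_iff (pow_ne_zero 2 hg)]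
    simp only [oddIntegrand]
    rw [e0, f0]
    -- Each second derivative contributes `½ S φ ψ`; together they match the anomaly of `R φ ψ`.
    linear_combination (-ψ i z) * e2 - φ i z * f2 + φ i z * ψ i z * hR

/-- The even integrand as a bilinear map into the differentials. -/
def evenForm (R : ProjConn U) (L : ThetaChar U) (A : Finset X) :
    forms U L A (-2) →ₗ[ℂ] forms U L A (-2) →ₗ[ℂ] forms U L A 2 :=
  LinearMap.mk₂ ℂ (fun e f => ⟨evenIntegrand R e.1 f.1, evenIntegrand_mem R e.2 f.2⟩)
    (fun e e' f => forms_ext fun i z hz => by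
      have h := forms_analyticAt e.2 hz
      have h' := forms_analyticAt e'.2 hz
      simp only [evenIntegrand, Submodule.coe_add, Pi.add_apply]
      rw [iteratedDeriv_add h.contDiffAt h'.contDiffAt,
        deriv_add h.differentiableAt h'.differentiableAt]
      ring)
    (fun c e f => forms_ext fun i z hz => by
      simp only [evenIntegrand, Submodule.coe_smul, Pi.smul_apply, iteratedDeriv_const_smul_field,
        deriv_const_smul_field, smul_eq_mul]
      ring)
    (fun f e e' => forms_ext fun i z hz => by
      have h := forms_analyticAt e.2 hz
      have h' := forms_analyticAt e'.2 hz
      simp only [evenIntegrand, Submodule.coe_add, Pi.add_apply]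
      rw [iteratedDeriv_add h.contDiffAt h'.contDiffAt,
        deriv_add h.differentiableAt h'.differentiableAt]
      ring)
    (fun c e f => forms_ext fun i z hz => by
      simp only [evenIntegrand, Submodule.coe_smul, Pi.smul_apply, iteratedDeriv_const_smul_field,
        deriv_const_smul_field, smul_eq_mul]
      ring)

/-- The odd integrand as a bilinear map into the differentials. -/
def oddForm (R : ProjConn U) (L : ThetaChar U) (A : Finset X) :
    forms U L A (-1) →ₗ[ℂ] forms U L A (-1) →ₗ[ℂ] forms U L A 2 :=
  LinearMap.mk₂ ℂ (fun φ ψ => ⟨oddIntegrand R φ.1 ψ.1, oddIntegrand_mem R φ.2 ψ.2⟩)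
    (fun e e' f => forms_ext fun i z hz => by
      have h := forms_analyticAt e.2 hz
      have h' := forms_analyticAt e'.2 hz
      simp only [oddIntegrand, Submodule.coe_add, Pi.add_apply]
      rw [iteratedDeriv_add h.contDiffAt h'.contDiffAt]
      ring)
    (fun c e f => forms_ext fun i z hz => by
      simp only [oddIntegrand, Submodule.coe_smul, Pi.smul_apply, iteratedDeriv_const_smul_field,
        smul_eq_mul]
      ring)
    (fun f e e' => forms_ext fun i z hz => by
      have h := forms_analyticAt e.2 hz
      have h' := forms_analyticAt e'.2 hz
      simp only [oddIntegrand, Submodule.coe_add, Pi.add_apply]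
      rw [iteratedDeriv_add h.contDiffAt h'.contDiffAt]
      ring)
    (fun c e f => forms_ext fun i z hz => by
      simp only [oddIntegrand, Submodule.coe_smul, Pi.smul_apply, iteratedDeriv_const_smul_field,
        smul_eq_mul]
      ring)

end Forms

/-! ### Integration of differentials along closed curves -/

section Integration

open Set MeasureTheory

variable {ι X : Type*} [TopologicalSpace X] [ChartedSpace ℂ X]
  {U : CoordCover ι X} {L : ThetaChar U} {A : Finset X} {C : ClosedCurve X} {t : ℝ}

theorem CoordCover.mem_source_index (U : CoordCover ι X) (x : X) :
    x ∈ (U.chart (U.index x)).source :=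
  (U.cover x).choose_spec

/-- A `C¹` curve is `C¹` in every coordinate of the covering. -/
theorem ClosedCurve.contDiffWithinAt_chart [IsManifold 𝓘(ℂ) ω X] (U : CoordCover ι X)
    (C : ClosedCurve X) (ht : t ∈ Icc (0 : ℝ) 1) {i : ι}
    (hi : C.toFun t ∈ (U.chart i).source) :
    ContDiffWithinAt ℝ 1 (fun s => U.chart i (C.toFun s)) (Icc 0 1) t := by
  set x := C.toFun t with hx
  obtain ⟨hcont, h1⟩ := contMDiffWithinAt_iff_target.1 (C.contMDiffOn t ht)
  rw [contMDiffWithinAt_iff_contDiffWithinAt] at h1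
  -- Smoothness of `C` refers to the preferred chart at `x`. The passage to `U.chart i` is complex
  -- analytic, since that chart lies in the maximal atlas, and so is real `C¹`.
  have h2 : ContMDiffAt 𝓘(ℂ) 𝓘(ℂ) ω (U.chart i ∘ (chartAt ℂ x).symm) (chartAt ℂ x x) := by
    have ha : ContMDiffAt 𝓘(ℂ) 𝓘(ℂ) ω (U.chart i) ((chartAt ℂ x).symm (chartAt ℂ x x)) := by
      rw [(chartAt ℂ x).left_inv (mem_chart_source ℂ x)]
      exact contMDiffAt_of_mem_maximalAtlas (U.chart_mem i) hi
    refine ha.comp _ ?_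
    exact (contMDiffOn_chart_symm (I := 𝓘(ℂ)) (n := ω) (x := x)).contMDiffAt
      ((chartAt ℂ x).open_target.mem_nhds (mem_chart_target ℂ x))
  rw [contMDiffAt_iff_contDiffAt] at h2
  have h3 : ContDiffAt ℝ 1 (U.chart i ∘ (chartAt ℂ x).symm) (chartAt ℂ x x) :=
    (h2.restrict_scalars ℝ).of_le le_top
  have h4 : ContDiffWithinAt ℝ 1 ((U.chart i ∘ (chartAt ℂ x).symm) ∘
      (extChartAt 𝓘(ℝ, ℂ) x ∘ C.toFun)) (Icc 0 1) t := by
    refine ContDiffAt.comp_contDiffWithinAt t ?_ h1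
    simpa [← hx] using h3
  refine h4.congr_of_eventuallyEq ?_ ?_
  · filter_upwards [hcont.preimage_mem_nhdsWithin
      ((chartAt ℂ x).open_source.mem_nhds (mem_chart_source ℂ x))] with s hs
    simp [(chartAt ℂ x).left_inv hs]
  · simp [← hx]

/-- The pull-back of a differential in a fixed coordinate, with the one-sided derivative of the
curve at the end points. -/
def pullbackIn (U : CoordCover ι X) (θ : ι → ℂ → ℂ) (C : ClosedCurve X) (i : ι) (t : ℝ) : ℂ :=
  θ i (U.chart i (C.toFun t)) * derivWithin (fun s => U.chart i (C.toFun s)) (Icc 0 1) t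

/-- Restricted to the open interval: at the end points the two-sided derivative depends on values of
the curve outside `[0, 1]`. Integrals do not see these two points. -/
theorem pullback_eq_pullbackIn (θ : ι → ℂ → ℂ) (ht : t ∈ Ioo (0 : ℝ) 1) :
    pullback U θ C t = pullbackIn U θ C (U.index (C.toFun t)) t := by
  rw [pullback, pullbackIn, derivWithin_of_mem_nhds (Icc_mem_nhds ht.1 ht.2)]

theorem CoordCover.chart_mem_punctured (U : CoordCover ι X) {x : X} (hA : x ∉ A) {i : ι}
    (hi : x ∈ (U.chart i).source) : U.chart i x ∈ U.punctured A i :=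
  ⟨(U.chart i).map_source hi, by rwa [(U.chart i).left_inv hi]⟩

theorem CoordCover.chart_mem_overlap (U : CoordCover ι X) {x : X} {i j : ι}
    (hi : x ∈ (U.chart i).source) (hj : x ∈ (U.chart j).source) :
    U.chart i x ∈ U.overlap i j :=
  ⟨(U.chart i).map_source hi, by rwa [(U.chart i).left_inv hi]⟩

theorem CoordCover.change_chart (U : CoordCover ι X) {x : X} {i j : ι}
    (hi : x ∈ (U.chart i).source) : U.change j i (U.chart i x) = U.chart j x := by
  rw [CoordCover.change, (U.chart i).left_inv hi]

theorem ClosedCurve.continuousWithinAt (C : ClosedCurve X) (ht : t ∈ Icc (0 : ℝ) 1) :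
    ContinuousWithinAt C.toFun (Icc 0 1) t :=
  (contMDiffWithinAt_iff_target.1 (C.contMDiffOn t ht)).1

theorem ClosedCurve.eventually_mem_source (U : CoordCover ι X) (C : ClosedCurve X)
    (ht : t ∈ Icc (0 : ℝ) 1) {i : ι} (hi : C.toFun t ∈ (U.chart i).source) :
    ∀ᶠ s in nhdsWithin t (Icc 0 1), C.toFun s ∈ (U.chart i).source :=
  (C.continuousWithinAt ht).preimage_mem_nhdsWithin ((U.chart i).open_source.mem_nhds hi)

variable [IsManifold 𝓘(ℂ) ω X]

theorem ClosedCurve.hasDerivWithinAt_chart (U : CoordCover ι X) (C : ClosedCurve X)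
    (ht : t ∈ Icc (0 : ℝ) 1) {i : ι} (hi : C.toFun t ∈ (U.chart i).source) :
    HasDerivWithinAt (fun s => U.chart i (C.toFun s))
      (derivWithin (fun s => U.chart i (C.toFun s)) (Icc 0 1) t) (Icc 0 1) t :=
  ((C.contDiffWithinAt_chart U ht hi).differentiableWithinAt one_ne_zero).hasDerivWithinAt

theorem derivWithin_chart_change (L : ThetaChar U) (ht : t ∈ Icc (0 : ℝ) 1) {i j : ι}
    (hi : C.toFun t ∈ (U.chart i).source) (hj : C.toFun t ∈ (U.chart j).source) :
    derivWithin (fun s => U.chart j (C.toFun s)) (Icc 0 1) t =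
      L.g j i (U.chart i (C.toFun t)) ^ 2 *
        derivWithin (fun s => U.chart i (C.toFun s)) (Icc 0 1) t := by
  have h1 := (L.hasDerivAt_change (U.chart_mem_overlap hi hj)).comp_hasDerivWithinAt t
    (C.hasDerivWithinAt_chart U ht hi)
  refine HasDerivWithinAt.derivWithin (h1.congr_of_eventuallyEq ?_ ?_)
    (uniqueDiffOn_Icc zero_lt_one t ht)
  · filter_upwards [C.eventually_mem_source U ht hi] with s hs
    exact (U.change_chart hs).symm
  · exact (U.change_chart hi).symm

/-- The factor `g⁻²` from the form cancels the factor `g²` from the chain rule for the curve. -/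
theorem pullbackIn_eq {θ : ι → ℂ → ℂ} (hθ : θ ∈ forms U L A 2) (ht : t ∈ Icc (0 : ℝ) 1)
    (hA : C.toFun t ∉ A) {i j : ι} (hi : C.toFun t ∈ (U.chart i).source)
    (hj : C.toFun t ∈ (U.chart j).source) : pullbackIn U θ C i t = pullbackIn U θ C j t := by
  have h := hθ.2.2.2 i j _ (U.chart_mem_overlap hi hj) (by rwa [(U.chart i).left_inv hi])
  have hg := L.ne_zero (U.chart_mem_overlap hi hj)
  rw [U.change_chart hi] at h
  rw [pullbackIn, pullbackIn, h, derivWithin_chart_change L ht hi hj, zpow_neg, zpow_ofNat]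
  field_simp

/-- The chosen index may jump along the curve. Near a given parameter it can be frozen, because the
pull-back does not depend on the chart. -/
theorem continuousOn_pullbackIn_index {θ : ι → ℂ → ℂ} (hθ : θ ∈ forms U L A 2)
    (hC : ∀ t ∈ Icc (0 : ℝ) 1, C.toFun t ∉ A) :
    ContinuousOn (fun t => pullbackIn U θ C (U.index (C.toFun t)) t) (Icc 0 1) := by
  intro t ht
  set i := U.index (C.toFun t) with hi'
  have hi : C.toFun t ∈ (U.chart i).source := U.mem_source_index _
  have hcd := C.contDiffWithinAt_chart U ht hi
  have h1 : ContinuousWithinAt (pullbackIn U θ C i) (Icc 0 1) t := by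
    refine ContinuousWithinAt.mul ?_ ?_
    · exact ContinuousAt.comp_continuousWithinAt (g := θ i)
        (hθ.2.1 i _ (U.chart_mem_punctured (hC t ht) hi)).continuousAt hcd.continuousWithinAt
    · exact (hcd.derivWithin (m := 0) (uniqueDiffOn_Icc zero_lt_one) (by simp) ht).continuousWithinAt
  refine h1.congr_of_eventuallyEq ?_ rfl
  filter_upwards [C.eventually_mem_source U ht hi, self_mem_nhdsWithin] with s hs hsI
  exact pullbackIn_eq hθ hsI (hC s hsI) (U.mem_source_index _) hs

theorem intervalIntegrable_pullback {θ : ι → ℂ → ℂ} (hθ : θ ∈ forms U L A 2)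
    (hC : ∀ t ∈ Icc (0 : ℝ) 1, C.toFun t ∉ A) :
    IntervalIntegrable (pullback U θ C) volume 0 1 := by
  refine ((continuousOn_pullbackIn_index hθ hC).intervalIntegrable_of_Icc zero_le_one).congr_uIoo ?_
  rw [uIoo_of_le zero_le_one]
  exact fun t ht => (pullback_eq_pullbackIn θ ht).symm

/-- The integral along `C` as a linear functional on the differentials. -/
def curveIntegralₗ (U : CoordCover ι X) (L : ThetaChar U) (A : Finset X) (C : ClosedCurve X)
    (hC : ∀ t ∈ Icc (0 : ℝ) 1, C.toFun t ∉ A) : forms U L A 2 →ₗ[ℂ] ℂ where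
  toFun θ := curveIntegral U θ.1 C
  map_add' θ η := by
    rw [curveIntegral, curveIntegral, curveIntegral, ← intervalIntegral.integral_add
      (intervalIntegrable_pullback θ.2 hC) (intervalIntegrable_pullback η.2 hC)]
    simp only [pullback, Submodule.coe_add, Pi.add_apply, add_mul]
  map_smul' c θ := by
    rw [curveIntegral, curveIntegral, RingHom.id_apply, smul_eq_mul,
      ← intervalIntegral.integral_const_mul]
    simp only [pullback, Submodule.coe_smul, Pi.smul_apply, smul_eq_mul, mul_assoc]

/-- The integral of an exact differential `dF` along a closed curve vanishes. -/
theorem curveIntegral_eq_zero_of_exact {θ F : ι → ℂ → ℂ} (hθ : θ ∈ forms U L A 2)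
    (hF : ∀ i, ∀ z ∈ U.punctured A i, HasDerivAt (F i) (θ i z) z)
    (hFc : ∀ i j, ∀ z ∈ U.puncturedOverlap A i j, F j (U.change j i z) = F i z)
    (hC : ∀ t ∈ Icc (0 : ℝ) 1, C.toFun t ∉ A) : curveIntegral U θ C = 0 := by
  -- The primitive along the curve. By `hFc` it agrees near each parameter with the expression in
  -- one fixed chart, which gives its derivative.
  let G : ℝ → ℂ := fun t => F (U.index (C.toFun t)) (U.chart (U.index (C.toFun t)) (C.toFun t))
  have hG : ∀ t ∈ Icc (0 : ℝ) 1,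
      HasDerivWithinAt G (pullbackIn U θ C (U.index (C.toFun t)) t) (Icc 0 1) t := by
    intro t ht
    set i := U.index (C.toFun t) with hi'
    have hi : C.toFun t ∈ (U.chart i).source := U.mem_source_index _
    have h1 := (hF i _ (U.chart_mem_punctured (hC t ht) hi)).comp_hasDerivWithinAt t
      (C.hasDerivWithinAt_chart U ht hi)
    refine h1.congr_of_eventuallyEq ?_ rfl
    filter_upwards [C.eventually_mem_source U ht hi, self_mem_nhdsWithin] with s hs hsI
    have hj := U.mem_source_index (C.toFun s)
    have := hFc i _ _ ⟨U.chart_mem_overlap hs hj, U.chart_mem_punctured (hC s hsI) hs⟩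
    rw [U.change_chart hs] at this
    exact this
  have := intervalIntegral.integral_eq_sub_of_hasDerivAt_of_le (f := G) (f' := pullback U θ C)
    zero_le_one (fun t ht => (hG t ht).continuousWithinAt)
    (fun t ht => by
      rw [pullback_eq_pullbackIn θ ht]
      exact (hG t (Ioo_subset_Icc_self ht)).hasDerivAt (Icc_mem_nhds ht.1 ht.2))
    (intervalIntegrable_pullback hθ hC)
  rw [curveIntegral, this]
  -- `G` depends on the parameter only through the point of the curve, index included, so its end
  -- values coincide.
  simp only [G, C.closed, sub_self]

end Integration

/-! ### The Jacobi identities -/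

section Bracket

variable {a b : ℂ → ℂ} {z : ℂ}

theorem iteratedDeriv_mul_deriv (ha : AnalyticAt ℂ a z) (hb : AnalyticAt ℂ b z) (k : ℕ) :
    iteratedDeriv k (fun w => a w * deriv b w) z = ∑ l ∈ Finset.range (k + 1),
      (k.choose l : ℂ) * iteratedDeriv l a z * iteratedDeriv (k - l + 1) b z := by
  rw [iteratedDeriv_fun_mul ha.contDiffAt hb.deriv.contDiffAt]
  simp only [iteratedDeriv_succ']

/-- The parameter `β` serves both actions: `β = 1` for vector fields and `β = 1/2` for spinors. This
is why `lieV_apply` keeps a factor `1`. -/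
theorem iteratedDeriv_bracket (ha : AnalyticAt ℂ a z) (hb : AnalyticAt ℂ b z) (β : ℂ) (k : ℕ) :
    iteratedDeriv k (fun w => a w * deriv b w - β * (b w * deriv a w)) z =
      (∑ l ∈ Finset.range (k + 1),
        (k.choose l : ℂ) * iteratedDeriv l a z * iteratedDeriv (k - l + 1) b z) -
      β * ∑ l ∈ Finset.range (k + 1),
        (k.choose l : ℂ) * iteratedDeriv l b z * iteratedDeriv (k - l + 1) a z := by
  rw [← iteratedDeriv_mul_deriv ha hb, ← iteratedDeriv_mul_deriv hb ha,
    iteratedDeriv_fun_sub (f := fun w => a w * deriv b w) (g := fun w => β * (b w * deriv a w))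
      (ha.mul hb.deriv).contDiffAt (analyticAt_const.mul (hb.mul ha.deriv)).contDiffAt,
    iteratedDeriv_const_mul_field]

theorem deriv_bracket (ha : AnalyticAt ℂ a z) (hb : AnalyticAt ℂ b z) (β : ℂ) :
    deriv (fun w => a w * deriv b w - β * (b w * deriv a w)) z =
      a z * iteratedDeriv 2 b z + deriv a z * deriv b z -
        β * (b z * iteratedDeriv 2 a z + deriv b z * deriv a z) := by
  rw [← iteratedDeriv_one, iteratedDeriv_bracket ha hb]
  simp [Finset.sum_range_succ]

theorem iteratedDeriv_two_bracket (ha : AnalyticAt ℂ a z) (hb : AnalyticAt ℂ b z) (β : ℂ) :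
    iteratedDeriv 2 (fun w => a w * deriv b w - β * (b w * deriv a w)) z =
      a z * iteratedDeriv 3 b z + 2 * deriv a z * iteratedDeriv 2 b z +
        iteratedDeriv 2 a z * deriv b z -
      β * (b z * iteratedDeriv 3 a z + 2 * deriv b z * iteratedDeriv 2 a z +
        iteratedDeriv 2 b z * deriv a z) := by
  rw [iteratedDeriv_bracket ha hb]
  simp [Finset.sum_range_succ]

theorem iteratedDeriv_three_bracket (ha : AnalyticAt ℂ a z) (hb : AnalyticAt ℂ b z) (β : ℂ) :
    iteratedDeriv 3 (fun w => a w * deriv b w - β * (b w * deriv a w)) z =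
      a z * iteratedDeriv 4 b z + 3 * deriv a z * iteratedDeriv 3 b z +
        3 * iteratedDeriv 2 a z * iteratedDeriv 2 b z + iteratedDeriv 3 a z * deriv b z -
      β * (b z * iteratedDeriv 4 a z + 3 * deriv b z * iteratedDeriv 3 a z +
        3 * iteratedDeriv 2 b z * iteratedDeriv 2 a z + iteratedDeriv 3 b z * deriv a z) := by
  rw [iteratedDeriv_bracket ha hb]
  simp [Finset.sum_range_succ]

theorem iteratedDeriv_three_mul (ha : AnalyticAt ℂ a z) (hb : AnalyticAt ℂ b z) :
    iteratedDeriv 3 (fun w => a w * b w) z =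
      a z * iteratedDeriv 3 b z + 3 * deriv a z * iteratedDeriv 2 b z +
        3 * iteratedDeriv 2 a z * deriv b z + iteratedDeriv 3 a z * b z := by
  rw [iteratedDeriv_fun_mul ha.contDiffAt hb.contDiffAt]
  simp [Finset.sum_range_succ]

end Bracket

section Jacobi

variable {ι X : Type*} [TopologicalSpace X] [ChartedSpace ℂ X]
  {U : CoordCover ι X} {L : ThetaChar U} {A : Finset X}

/-- The product of forms of weight `-1/2`. -/
abbrev mulS : forms U L A (-1) →ₗ[ℂ] forms U L A (-1) →ₗ[ℂ] forms U L A (-2) :=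
  formMul U L A (-1) (-1) (-2) (by norm_num)

theorem mulS_apply (φ ψ : forms U L A (-1)) (i : ι) :
    (mulS φ ψ).1 i = fun z => φ.1 i z * ψ.1 i z := rfl

theorem deriv_mulS (φ ψ : forms U L A (-1)) {i : ι} {z : ℂ} (hz : z ∈ U.punctured A i) :
    deriv (fun z => φ.1 i z * ψ.1 i z) z =
      deriv (φ.1 i) z * ψ.1 i z + φ.1 i z * deriv (ψ.1 i) z :=
  deriv_fun_mul (φ.2.2.1 i z hz) (ψ.2.2.1 i z hz)

theorem mulS_comm (φ ψ : forms U L A (-1)) : mulS φ ψ = mulS ψ φ :=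
  forms_ext fun i z _ => by simp only [mulS_apply, mul_comm]

theorem mem_parity_zero {v : KNSuper U L A} : v ∈ parity U L A 0 ↔ v.2 = 0 := by
  simp [parity, Submodule.mem_prod]

theorem mem_parity_one {v : KNSuper U L A} : v ∈ parity U L A 1 ↔ v.1 = 0 := by
  simp [parity, Submodule.mem_prod]

variable [T1Space X]

/-- The Lie bracket of vector fields. -/
abbrev lieV : forms U L A (-2) →ₗ[ℂ] forms U L A (-2) →ₗ[ℂ] forms U L A (-2) :=
  formBracket U L A (-2) (-2) (-2) (by norm_num)

/-- The Lie derivative of forms of weight `-1/2`. -/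
abbrev lieS : forms U L A (-2) →ₗ[ℂ] forms U L A (-1) →ₗ[ℂ] forms U L A (-1) :=
  formBracket U L A (-2) (-1) (-1) (by norm_num)

theorem lieV_apply (e f : forms U L A (-2)) (i : ι) :
    (lieV e f).1 i = fun z => e.1 i z * deriv (f.1 i) z - 1 * (f.1 i z * deriv (e.1 i) z) := by
  funext z
  change -(((-2 : ℤ) : ℂ) / 2) * e.1 i z * deriv (f.1 i) z +
    (((-2 : ℤ) : ℂ) / 2) * f.1 i z * deriv (e.1 i) z = _
  push_cast
  ring

theorem lieS_apply (e : forms U L A (-2)) (φ : forms U L A (-1)) (i : ι) :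
    (lieS e φ).1 i =
      fun z => e.1 i z * deriv (φ.1 i) z - 1 / 2 * (φ.1 i z * deriv (e.1 i) z) := by
  funext z
  change -(((-2 : ℤ) : ℂ) / 2) * e.1 i z * deriv (φ.1 i) z +
    (((-1 : ℤ) : ℂ) / 2) * φ.1 i z * deriv (e.1 i) z = _
  push_cast
  ring

theorem lieV_skew (e f : forms U L A (-2)) : lieV e f = -lieV f e := by
  refine forms_ext fun i z _ => ?_
  simp only [Submodule.coe_neg, Pi.neg_apply, lieV_apply]
  ring

theorem lieV_jacobi (e f g : forms U L A (-2)) :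
    lieV e (lieV f g) + lieV f (lieV g e) + lieV g (lieV e f) = 0 := by
  refine forms_ext fun i z hz => ?_
  have he := forms_analyticAt e.2 hz
  have hf := forms_analyticAt f.2 hz
  have hg := forms_analyticAt g.2 hz
  simp only [Submodule.coe_add, Pi.add_apply, lieV_apply, Submodule.coe_zero, Pi.zero_apply,
    deriv_bracket he hf, deriv_bracket hf hg, deriv_bracket hg he]
  ring

theorem lieS_lieV (e f : forms U L A (-2)) (φ : forms U L A (-1)) :
    lieS (lieV e f) φ = lieS e (lieS f φ) - lieS f (lieS e φ) := by
  refine forms_ext fun i z hz => ?_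
  have he := forms_analyticAt e.2 hz
  have hf := forms_analyticAt f.2 hz
  have hφ := forms_analyticAt φ.2 hz
  simp only [AddSubgroupClass.coe_sub, Pi.sub_apply, lieV_apply, lieS_apply,
    deriv_bracket he hf, deriv_bracket hf hφ, deriv_bracket he hφ]
  ring

theorem lieV_mulS (e : forms U L A (-2)) (φ ψ : forms U L A (-1)) :
    lieV e (mulS φ ψ) = mulS φ (lieS e ψ) + mulS ψ (lieS e φ) := by
  refine forms_ext fun i z hz => ?_
  simp only [Submodule.coe_add, Pi.add_apply, lieV_apply, lieS_apply, mulS_apply,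
    deriv_mulS φ ψ hz]
  ring

/-- The cyclic sum of `ψ χ φ'` and that of `½ φ (ψ χ)'` both equal `(φ ψ χ)'`. -/
theorem lieS_mulS_cyclic (φ ψ χ : forms U L A (-1)) :
    lieS (mulS ψ χ) φ + lieS (mulS χ φ) ψ + lieS (mulS φ ψ) χ = 0 := by
  refine forms_ext fun i z hz => ?_
  simp only [Submodule.coe_add, Pi.add_apply, lieS_apply, mulS_apply, Submodule.coe_zero,
    Pi.zero_apply, deriv_mulS _ _ hz]
  ring

theorem superBracket_apply (v w : KNSuper U L A) :
    superBracket U L A v w =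
      (lieV v.1 w.1 + mulS v.2 w.2, lieS v.1 w.2 - lieS w.1 v.2) := rfl

/-- Up to cyclic rotation the Jacobi identity says: vector fields form a Lie algebra
(`lieV_jacobi`), they act on spinors (`lieS_lieV`), they act by derivations of the product
(`lieV_mulS`), and `lieS_mulS_cyclic` holds for three spinors. -/
theorem isLieSuperalgebra_superBracket :
    IsLieSuperalgebra (parity U L A) (superBracket U L A) where
  isCompl := by
    simpa [parity] using isCompl_prod
      (isCompl_top_bot (α := Submodule ℂ (forms U L A (-2))))
      (isCompl_bot_top (α := Submodule ℂ (forms U L A (-1))))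
  graded a b x hx y hy := by
    rcases zmod_two_cases a with rfl | rfl <;> rcases zmod_two_cases b with rfl | rfl <;>
      simp only [add_zero, zero_add, CharTwo.add_self_eq_zero, mem_parity_zero, mem_parity_one,
        superBracket_apply] at hx hy ⊢ <;> simp [hx, hy]
  skew a b x hx y hy := by
    rcases zmod_two_cases a with rfl | rfl <;> rcases zmod_two_cases b with rfl | rfl <;>
      simp only [mem_parity_zero, mem_parity_one, superBracket_apply] at hx hy ⊢
    · ext1 <;> simp [hx, hy, lieV_skew x.1 y.1]
    · ext1 <;> simp [hx, hy]
    · ext1 <;> simp [hx, hy]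
    · ext1 <;> simp [hx, hy, mulS_comm x.2 y.2]
  jacobi := by
    refine parity_cyclic_induction (Q := fun a b c x y z =>
      sgn a c • superBracket U L A x (superBracket U L A y z) +
      sgn b a • superBracket U L A y (superBracket U L A z x) +
      sgn c b • superBracket U L A z (superBracket U L A x y) = 0) ?_ ?_ ?_ ?_ ?_
    · intro a b d x y z h
      rw [← h]
      abel
    · rintro ⟨e, φ⟩ hx ⟨f, ψ⟩ hy ⟨g, χ⟩ hz
      simp only [mem_parity_zero] at hx hy hz
      subst hx hy hz
      ext1
      · simpa [superBracket_apply] using lieV_jacobi e f g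
      · simp [superBracket_apply]
    · rintro ⟨e, φ⟩ hx ⟨f, ψ⟩ hy ⟨g, χ⟩ hz
      simp only [mem_parity_zero, mem_parity_one] at hx hy hz
      subst hx hy hz
      ext1
      · simp [superBracket_apply]
      · simp only [superBracket_apply, sgn_zero_left, sgn_zero_right, map_zero,
          LinearMap.zero_apply, zero_sub, sub_zero, add_zero, zero_add, one_smul, map_neg,
          Prod.snd_add, Prod.snd_zero, lieS_lieV]
        abel
    · rintro ⟨e, φ⟩ hx ⟨f, ψ⟩ hy ⟨g, χ⟩ hz
      simp only [mem_parity_zero, mem_parity_one] at hx hy hz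
      subst hx hy hz
      ext1
      · simp only [superBracket_apply, sgn_zero_left, sgn_zero_right, sgn_one_one, map_zero,
          LinearMap.zero_apply, zero_sub, sub_zero, add_zero, zero_add, one_smul, map_neg,
          Prod.fst_add, Prod.fst_zero, Prod.smul_fst, lieV_mulS]
        module
      · simp [superBracket_apply]
    · rintro ⟨e, φ⟩ hx ⟨f, ψ⟩ hy ⟨g, χ⟩ hz
      simp only [mem_parity_one] at hx hy hz
      subst hx hy hz
      ext1
      · simp [superBracket_apply]
      · simpa [superBracket_apply] using lieS_mulS_cyclic φ ψ χ

end Jacobi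

/-! ### The cocycle -/

section Cocycle

variable {ι X : Type*} [TopologicalSpace X] [ChartedSpace ℂ X] [T1Space X]
  {U : CoordCover ι X} {L : ThetaChar U} {A : Finset X} {R : ProjConn U}

theorem evenForm_apply (e f : forms U L A (-2)) (i : ι) (z : ℂ) :
    (evenForm R L A e f).1 i z =
      1 / 2 * (iteratedDeriv 3 (e.1 i) z * f.1 i z - e.1 i z * iteratedDeriv 3 (f.1 i) z) -
      R.R i z * (deriv (e.1 i) z * f.1 i z - e.1 i z * deriv (f.1 i) z) := rfl

theorem oddForm_apply (φ ψ : forms U L A (-1)) (i : ι) (z : ℂ) :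
    (oddForm R L A φ ψ).1 i z =
      -(iteratedDeriv 2 (φ.1 i) z * ψ.1 i z + φ.1 i z * iteratedDeriv 2 (ψ.1 i) z -
        R.R i z * φ.1 i z * ψ.1 i z) := rfl

theorem evenForm_skew (e f : forms U L A (-2)) :
    evenForm R L A e f = -evenForm R L A f e := by
  refine forms_ext fun i z _ => ?_
  simp only [Submodule.coe_neg, Pi.neg_apply, evenForm_apply]
  ring

theorem oddForm_comm (φ ψ : forms U L A (-1)) :
    oddForm R L A φ ψ = oddForm R L A ψ φ := by
  refine forms_ext fun i z _ => ?_
  simp only [oddForm_apply]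
  ring

/-- The bilinear form `Φ` of a linear functional `J` on the differentials. -/
def superCocycle (R : ProjConn U) (L : ThetaChar U) (A : Finset X) (J : forms U L A 2 →ₗ[ℂ] ℂ) :
    KNSuper U L A →ₗ[ℂ] KNSuper U L A →ₗ[ℂ] ℂ :=
  LinearMap.mk₂ ℂ (fun v w => J (evenForm R L A v.1 w.1) + J (oddForm R L A v.2 w.2))
    (by intro _ _ _; simp; ring) (by intro _ _ _; simp; ring)
    (by intro _ _ _; simp; ring) (by intro _ _ _; simp; ring)

theorem superCocycle_apply (J : forms U L A 2 →ₗ[ℂ] ℂ) (v w : KNSuper U L A) :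
    superCocycle R L A J v w = J (evenForm R L A v.1 w.1) + J (oddForm R L A v.2 w.2) := rfl

/-- Only the types with an even number of odd arguments carry content. In the other two types every
term pairs elements of opposite parity. The minus signs in `h₁` come from `[ψ, e] = -e.ψ` and from
`sgn 1 1 = -1`. -/
theorem isEvenCocycle_superCocycle (J : forms U L A 2 →ₗ[ℂ] ℂ)
    (h₀ : ∀ e f g : forms U L A (-2), J (evenForm R L A e (lieV f g) +
      evenForm R L A f (lieV g e) + evenForm R L A g (lieV e f)) = 0)
    (h₁ : ∀ (e : forms U L A (-2)) (φ ψ : forms U L A (-1)), J (evenForm R L A e (mulS φ ψ) -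
      oddForm R L A φ (lieS e ψ) - oddForm R L A ψ (lieS e φ)) = 0) :
    IsEvenCocycle (parity U L A) (superBracket U L A) (superCocycle R L A J) where
  even a b hab x hx y hy := by
    rcases zmod_two_cases a with rfl | rfl <;> rcases zmod_two_cases b with rfl | rfl
    · exact absurd rfl hab
    · rw [mem_parity_zero] at hx
      rw [mem_parity_one] at hy
      simp [superCocycle_apply, hx, hy]
    · rw [mem_parity_one] at hx
      rw [mem_parity_zero] at hy
      simp [superCocycle_apply, hx, hy]
    · exact absurd rfl hab
  skew a b x hx y hy := by
    rcases zmod_two_cases a with rfl | rfl <;> rcases zmod_two_cases b with rfl | rfl <;>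
      simp only [mem_parity_zero, mem_parity_one] at hx hy <;>
      simp [superCocycle_apply, hx, hy]
    · rw [evenForm_skew, map_neg]
    · rw [oddForm_comm]
  cocycle := by
    refine parity_cyclic_induction (Q := fun a b c x y z =>
      sgn a c * superCocycle R L A J x (superBracket U L A y z) +
      sgn b a * superCocycle R L A J y (superBracket U L A z x) +
      sgn c b * superCocycle R L A J z (superBracket U L A x y) = 0) ?_ ?_ ?_ ?_ ?_
    · intro a b d x y z h
      rw [← h]
      ring
    · rintro ⟨e, φ⟩ hx ⟨f, ψ⟩ hy ⟨g, χ⟩ hz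
      simp only [mem_parity_zero] at hx hy hz
      subst hx hy hz
      simpa [superCocycle_apply, superBracket_apply] using h₀ e f g
    · rintro ⟨e, φ⟩ hx ⟨f, ψ⟩ hy ⟨g, χ⟩ hz
      simp only [mem_parity_zero, mem_parity_one] at hx hy hz
      subst hx hy hz
      simp [superCocycle_apply, superBracket_apply]
    · rintro ⟨e, φ⟩ hx ⟨f, ψ⟩ hy ⟨g, χ⟩ hz
      simp only [mem_parity_zero, mem_parity_one] at hx hy hz
      subst hx hy hz
      simpa [superCocycle_apply, superBracket_apply, sub_eq_add_neg] using h₁ e ψ χ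
    · rintro ⟨e, φ⟩ hx ⟨f, ψ⟩ hy ⟨g, χ⟩ hz
      simp only [mem_parity_one] at hx hy hz
      subst hx hy hz
      simp [superCocycle_apply, superBracket_apply]

variable [IsManifold 𝓘(ℂ) ω X] {C : ClosedCurve X} (hC : ∀ t ∈ Set.Icc (0 : ℝ) 1, C.toFun t ∉ A)

/-- The cocycle identity on vector fields: the cyclic sum is `-½ dW` with the Wronskian `W`. -/
theorem curveIntegral_evenForm_cyclic (e f g : forms U L A (-2)) :
    curveIntegralₗ U L A C hC (evenForm R L A e (lieV f g) + evenForm R L A f (lieV g e) +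
      evenForm R L A g (lieV e f)) = 0 := by
  refine curveIntegral_eq_zero_of_exact (Subtype.property _) (F := fun i z =>
    -1 / 2 * (e.1 i z * (deriv (f.1 i) z * iteratedDeriv 2 (g.1 i) z -
        deriv (g.1 i) z * iteratedDeriv 2 (f.1 i) z) +
      f.1 i z * (deriv (g.1 i) z * iteratedDeriv 2 (e.1 i) z -
        deriv (e.1 i) z * iteratedDeriv 2 (g.1 i) z) +
      g.1 i z * (deriv (e.1 i) z * iteratedDeriv 2 (f.1 i) z -
        deriv (f.1 i) z * iteratedDeriv 2 (e.1 i) z))) (fun i z hz => ?_)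
    (fun i j z hz => ?_) hC
  · have he := forms_analyticAt e.2 hz
    have hf := forms_analyticAt f.2 hz
    have hg := forms_analyticAt g.2 hz
    have e0 := he.differentiableAt.hasDerivAt
    have f0 := hf.differentiableAt.hasDerivAt
    have g0 := hg.differentiableAt.hasDerivAt
    have e1 := hasDerivAt_deriv he
    have f1 := hasDerivAt_deriv hf
    have g1 := hasDerivAt_deriv hg
    have e2 := hasDerivAt_iteratedDeriv he 2
    have f2 := hasDerivAt_iteratedDeriv hf 2
    have g2 := hasDerivAt_iteratedDeriv hg 2
    refine ((((e0.fun_mul ((f1.fun_mul g2).fun_sub (g1.fun_mul f2))).fun_add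
      (f0.fun_mul ((g1.fun_mul e2).fun_sub (e1.fun_mul g2)))).fun_add
      (g0.fun_mul ((e1.fun_mul f2).fun_sub (f1.fun_mul e2)))).const_mul (-1 / 2)).congr_deriv ?_
    simp only [Submodule.coe_add, Pi.add_apply, evenForm_apply, lieV_apply,
      deriv_bracket he hf, deriv_bracket hf hg, deriv_bracket hg he,
      iteratedDeriv_three_bracket he hf, iteratedDeriv_three_bracket hf hg,
      iteratedDeriv_three_bracket hg he, Nat.reduceAdd]
    ring
  -- The 2-jet of a vector field transforms by a triangular matrix with diagonal `g², 1, g⁻²`. Its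
  -- determinant is `1`, so `W` is invariant.
  · obtain ⟨e0, e1, e2, -⟩ := vector_jet e.2 hz
    obtain ⟨f0, f1, f2, -⟩ := vector_jet f.2 hz
    obtain ⟨g0, g1, g2, -⟩ := vector_jet g.2 hz
    have h0 := L.ne_zero hz.1
    rw [← eq_div_iff (pow_ne_zero 2 h0)] at e2 f2 g2
    simp only [e0, e1, e2, f0, f1, f2, g0, g1, g2]
    field_simp
    ring

/-- The cocycle identity on one vector field and two forms of weight `-1/2`. -/
theorem curveIntegral_evenForm_mulS (e : forms U L A (-2)) (φ ψ : forms U L A (-1)) :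
    curveIntegralₗ U L A C hC (evenForm R L A e (mulS φ ψ) - oddForm R L A φ (lieS e ψ) -
      oddForm R L A ψ (lieS e φ)) = 0 := by
  -- The primitive comes from integrating by parts in `e`: after `R` cancels, the integrand is `-½
  -- e''' φ ψ + e' (φ'' ψ + φ ψ'') + ½ e (φ''' ψ + φ ψ''' - φ'' ψ' - φ' ψ'')`, with no `e''` term.
  refine curveIntegral_eq_zero_of_exact (Subtype.property _) (F := fun i z =>
    1 / 2 * (deriv (e.1 i) z * (deriv (φ.1 i) z * ψ.1 i z + φ.1 i z * deriv (ψ.1 i) z) -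
      iteratedDeriv 2 (e.1 i) z * (φ.1 i z * ψ.1 i z) +
      e.1 i z * (iteratedDeriv 2 (φ.1 i) z * ψ.1 i z + φ.1 i z * iteratedDeriv 2 (ψ.1 i) z -
        2 * (deriv (φ.1 i) z * deriv (ψ.1 i) z)))) (fun i z hz => ?_)
    (fun i j z hz => ?_) hC
  · have he := forms_analyticAt e.2 hz
    have hf := forms_analyticAt φ.2 hz
    have hg := forms_analyticAt ψ.2 hz
    have e0 := he.differentiableAt.hasDerivAt
    have f0 := hf.differentiableAt.hasDerivAt
    have g0 := hg.differentiableAt.hasDerivAt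
    have e1 := hasDerivAt_deriv he
    have f1 := hasDerivAt_deriv hf
    have g1 := hasDerivAt_deriv hg
    have e2 := hasDerivAt_iteratedDeriv he 2
    have f2 := hasDerivAt_iteratedDeriv hf 2
    have g2 := hasDerivAt_iteratedDeriv hg 2
    refine ((((e1.fun_mul ((f1.fun_mul g0).fun_add (f0.fun_mul g1))).fun_sub
      (e2.fun_mul (f0.fun_mul g0))).fun_add
      (e0.fun_mul (((f2.fun_mul g0).fun_add (f0.fun_mul g2)).fun_sub
        ((f1.fun_mul g1).const_mul 2)))).const_mul (1 / 2)).congr_deriv ?_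
    simp only [AddSubgroupClass.coe_sub, Pi.sub_apply, evenForm_apply, oddForm_apply, lieS_apply,
      mulS_apply, deriv_mulS _ _ hz, iteratedDeriv_three_mul hf hg,
      iteratedDeriv_two_bracket he hf, iteratedDeriv_two_bracket he hg, Nat.reduceAdd]
    ring
  · obtain ⟨e0, e1, e2, -⟩ := vector_jet e.2 hz
    obtain ⟨f0, f1, f2⟩ := spinor_jet φ.2 hz
    obtain ⟨g0, g1, g2⟩ := spinor_jet ψ.2 hz
    have h0 := L.ne_zero hz.1
    rw [← eq_div_iff (pow_ne_zero _ h0)] at e2 f2 g2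
    rw [← eq_div_iff h0] at f1 g1
    simp only [e0, e1, e2, f0, f1, f2, g0, g1, g2]
    field_simp
    ring

end Cocycle

end KN

end

/-! ### The cocycle of a finite family of closed curves -/

theorem mainTheorem4
    {X : Type*} [TopologicalSpace X] [T2Space X] [CompactSpace X] [ConnectedSpace X]
    [ChartedSpace ℂ X] [IsManifold 𝓘(ℂ) ω X]
    {ι : Type*} (U : KN.CoordCover ι X) (L : KN.ThetaChar U) (A : Finset X)
    (R : KN.ProjConn U)
    (r : ℕ) (C : Fin r → KN.ClosedCurve X)
    (hC : ∀ k, ∀ t ∈ Set.Icc (0 : ℝ) 1, (C k).toFun t ∉ A) :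
    -- the integrands are well-defined meromorphic differentials, holomorphic outside `A`,
    -- and the integrals along `C` exist
    (∀ e f : KN.forms U L A (-2),
      KN.evenIntegrand R e.1 f.1 ∈ KN.forms U L A 2 ∧
      ∀ k, IntervalIntegrable (KN.pullback U (KN.evenIntegrand R e.1 f.1) (C k))
        MeasureTheory.volume 0 1) ∧
    (∀ φ ψ : KN.forms U L A (-1),
      KN.oddIntegrand R φ.1 ψ.1 ∈ KN.forms U L A 2 ∧
      ∀ k, IntervalIntegrable (KN.pullback U (KN.oddIntegrand R φ.1 ψ.1) (C k))
        MeasureTheory.volume 0 1) ∧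
    -- the bilinear extension exists, is a cocycle and defines a central extension
    ∃ Φ : KN.KNSuper U L A →ₗ[ℂ] KN.KNSuper U L A →ₗ[ℂ] ℂ,
      (∀ e f : KN.forms U L A (-2),
        Φ (e, 0) (f, 0) = ∑ k, KN.curveIntegral U (KN.evenIntegrand R e.1 f.1) (C k)) ∧
      (∀ φ ψ : KN.forms U L A (-1),
        Φ (0, φ) (0, ψ) = ∑ k, KN.curveIntegral U (KN.oddIntegrand R φ.1 ψ.1) (C k)) ∧
      (∀ (e : KN.forms U L A (-2)) (φ : KN.forms U L A (-1)),
        Φ (e, 0) (0, φ) = 0 ∧ Φ (0, φ) (e, 0) = 0) ∧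
      KN.IsLieSuperalgebra (KN.parity U L A) (KN.superBracket U L A) ∧
      KN.IsEvenCocycle (KN.parity U L A) (KN.superBracket U L A) Φ ∧
      KN.IsCentralExtension (KN.parity U L A) (KN.superBracket U L A)
        (KN.extParity (KN.parity U L A)) (KN.extBracket (KN.superBracket U L A) Φ)
        (LinearMap.inl ℂ ℂ (KN.KNSuper U L A)) (LinearMap.snd ℂ ℂ (KN.KNSuper U L A)) := by
  -- The criterion for `superCocycle` is linear in the functional, so each closed curve contributes
  -- zero separately.
  let J : KN.forms U L A 2 →ₗ[ℂ] ℂ := ∑ k, KN.curveIntegralₗ U L A (C k) (hC k)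
  have hJ : ∀ θ, J θ = ∑ k, KN.curveIntegral U θ.1 (C k) := fun θ =>
    LinearMap.sum_apply _ _ _
  have hΦ : KN.IsEvenCocycle (KN.parity U L A) (KN.superBracket U L A)
      (KN.superCocycle R L A J) := by
    refine KN.isEvenCocycle_superCocycle J (fun e f g => ?_) (fun e φ ψ => ?_)
    · exact (hJ _).trans (Finset.sum_eq_zero fun k _ =>
        KN.curveIntegral_evenForm_cyclic (hC k) e f g)
    · exact (hJ _).trans (Finset.sum_eq_zero fun k _ =>
        KN.curveIntegral_evenForm_mulS (hC k) e φ ψ)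
  refine ⟨fun e f => ⟨KN.evenIntegrand_mem R e.2 f.2, fun k =>
      KN.intervalIntegrable_pullback (KN.evenIntegrand_mem R e.2 f.2) (hC k)⟩,
    fun φ ψ => ⟨KN.oddIntegrand_mem R φ.2 ψ.2, fun k =>
      KN.intervalIntegrable_pullback (KN.oddIntegrand_mem R φ.2 ψ.2) (hC k)⟩,
    KN.superCocycle R L A J, fun e f => ?_, fun φ ψ => ?_, fun e φ => ?_,
    KN.isLieSuperalgebra_superBracket, hΦ,
    hΦ.isCentralExtension KN.isLieSuperalgebra_superBracket⟩
  · exact (show _ = J (KN.evenForm R L A e f) by simp [KN.superCocycle_apply]).trans (hJ _)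
  · exact (show _ = J (KN.oddForm R L A φ ψ) by simp [KN.superCocycle_apply]).trans (hJ _)
  · simp [KN.superCocycle_apply]
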